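/- **Setting.** Let $(P_\vartheta)_{\vartheta\in\Theta}$ be probability measures on a measurable space $\mathcal X$, let $\emptyset\ne H_i\subseteq\Theta$ ($i\in\mathbb N=\{1,2,\dots\}$) be null hypotheses, and let $p_i:\mathcal X\to[0,1]$ be p-values, i.e. measurable with $0<P_\vartheta(p_i\le x)\le x$ for all $\vartheta\in H_i$, $x\in(0,1]$. Put $I_0(\vartheta)=\{i:\vartheta\in H_i\}$. For $I\subseteq\mathbb N$ put $n_0(n)=|I\cap\{1,\dots,n\}|$, $\zeta_n=n_0(n)/n$, $n_1=n-n_0$ (with $I=I_0(\vartheta)$ write $\zeta_n(\vartheta)$). For every $I\subseteq \mathbb N$ let $P_I$ be a probability measure on $\mathcal X$ (Dirac-uniform configuration) under which the $p_i$, $i\in I$, are i.i.d. uniform on $[0,1]$ and $p_i=0$ almost surely for $i\notin I$. A *critical value function* is a continuous nondecreasing $\rho:[0,1]\to[0,1]$ with $\rho(0)=0$ and $\rho>0$ on $(0,1]$. Its *rejection curve* is $r(x)=\inf\{u\in[0,1]:\rho(u)=x\}$, $x\in[0,1]$, with $\inf\emptyset=\infty$; $r$ and $\rho$ determine each other. Put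 $\alpha_{j:n}=\rho(j/n)$ and let $p_{1:n}\le\dots\le p_{n:n}$ be the ordered p-values. The *step-up-down procedure* $\varphi_{n,\ell}^{(r)}$ of order $\ell\in\{1,\dots,n\}$ rejects $H_i$, $i\le n$, iff $p_i\le\alpha_{m_n:n}$, where $m_n=\max\{j\in\{\ell,\dots,n\}:p_{i:n}\le\alpha_{i:n}\text{ for all }\ell\le i\le j\}$ if $p_{\ell:n}\le\alpha_{\ell:n}$, and $m_n=\sup\{j\in\{1,\dots,\ell\}:p_{j:n}\le\alpha_{j:n}\}$ otherwise (nothing is rejected if this set is empty). For $\lambda\in[0,1]$ put $\lambda_n=\inf\{j\in\{1,\dots,n\}:\alpha_{j:n}\ge\lambda\}$, with $\inf\emptyset=n$. The case $\lambda=1$ gives the step-up procedure $\varphi^{(r)}_{n,n}$. Let $R_n$ be the number of rejections and $V_n$ the number of rejected true hypotheses. $\mathrm{FDR}_\vartheta=\mathbb E_\vartheta[V_n/(R_n\vee1)]$ (true hypotheses $I_0(\vartheta)$), $\mathrm{FDR}_{I}$ is the same expectation under $P_{I}$ with true hypotheses $I$, and the power is $\bar\beta_\vartheta=\mathbb E_\vartheta[(R_n-V_n)/(n_1\vee1)]$.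 Let $\alpha\in(0,1)$ and $f_\alpha(t)=t/(t(1-\alpha)+\alpha)$. Let $\mathcal M_\lambda$ be the set of rejection curves $r$ such that, for all $I\subseteq\mathbb N$ for which $\zeta_n$ converges to some $\zeta\in[0,1]$, $$\limsup_{n\to\infty}\mathrm{FDR}_{I}(\varphi_{n,\lambda_n}^{(r)})\le\limsup_{n\to\infty}\sup_{\vartheta\in\Theta}\mathrm{FDR}_\vartheta(\varphi_{n,\lambda_n}^{(r)})\le\alpha. \qquad(*)$$ **Theorem (asymptotic optimality of $f_\alpha$).** (i) Let $\lambda\in[0,1]$ and $r\in\mathcal M_\lambda$. Then $r(t)\ge f_\alpha(t)$ for all $t\in[0,\lambda]$. If $\lambda<1$, then for every $\tau\in(\lambda,1]$: if $r(t)\le f_\alpha(t)$ for all $t\in(\lambda,\tau]$, then $r(t)=f_\alpha(t)$ for all $t\in(\lambda,\tau]$. (ii) If $\lambda\in[0,1)$ and $r\in\mathcal M_\lambda$, with critical value function $\rho$, is such that for every $\zeta\in(\alpha,1)$ the equation $1-\zeta+\zeta\rho(t)=t$ has at most one solution $t\in(0,1)$, then $r(t)\ge f_\alpha(t)$ for all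 $t\in[0,1]$. (iii) Let $\lambda=1$, and assume that for every $\vartheta\in\Theta$ the $p_i$, $i\in I_0(\vartheta)$, are i.i.d. uniform on $[0,1]$ under $P_\vartheta$, and that for every $n$ the vectors $(p_i: i\le n,\ i\in I_0(\vartheta))$ and $(p_i: i\le n,\ i\notin I_0(\vartheta))$ are independent under $P_\vartheta$. (a) If the model is such that the first inequality in $(*)$ with $\lambda=1$ holds for every rejection curve $r$ and all $I$ as above, then $\inf_{r\in\mathcal M_1}r(t)=f_\alpha(t)$ for all $t\in[0,1)$. (b) Let $\kappa\in(0,1)$ and $\Theta_\kappa=\{\vartheta\in\Theta:\liminf_{n\to\infty}\zeta_n(\vartheta)>\alpha/(\kappa(1-\alpha)+\alpha)\}$. If $\tilde f_\alpha\in\mathcal M_1$ satisfies $\tilde f_\alpha(t)=f_\alpha(t)$ for all $t\in[0,\kappa]$, then for every $r\in\mathcal M_1$ and every $\vartheta\in\Theta_\kappa$ $$\liminf_{n\to\infty}\bigl[\bar\beta_\vartheta(\varphi_{n,n}^{(\tilde f_\alpha)})-\bar\beta_\vartheta(\varphi_{n,n}^{(r)})\bigr]\ge0.$$ -/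

import Mathlib

open MeasureTheory ProbabilityTheory Filter Topology Set

noncomputable section

namespace MultipleTesting

/-- A statistical experiment `(P ϑ)` on `Ω` with null hypotheses `H i ⊆ Θ` and p-values `p i`,
together with the Dirac-uniform configurations `DU I`, `I ⊆ ℕ`: under `DU I` the p-values with
index in `I` are i.i.d. uniform on `[0,1]` and the others are almost surely `0`.
Hypotheses are numbered from `0`, so the first `n` of them are those with index `i < n`. -/
structure Model (Θ Ω : Type*) [MeasurableSpace Ω] where
  P : Θ → Measure Ω
  isProb : ∀ ϑ, IsProbabilityMeasure (P ϑ)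
  H : ℕ → Set Θ
  H_nonempty : ∀ i, (H i).Nonempty
  p : ℕ → Ω → ℝ
  p_measurable : ∀ i, Measurable (p i)
  p_mem : ∀ i ω, p i ω ∈ Icc (0 : ℝ) 1
  /-- validity of the p-values under the null hypotheses -/
  p_valid : ∀ i, ∀ ϑ ∈ H i, ∀ x ∈ Ioc (0 : ℝ) 1,
    0 < P ϑ {ω | p i ω ≤ x} ∧ P ϑ {ω | p i ω ≤ x} ≤ ENNReal.ofReal x
  DU : Set ℕ → Measure Ω
  DU_isProb : ∀ I, IsProbabilityMeasure (DU I)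
  DU_uniform : ∀ I, ∀ i ∈ I, (DU I).map (p i) = volume.restrict (Icc (0 : ℝ) 1)
  DU_indep : ∀ I : Set ℕ, iIndepFun (fun i : I => p i) (DU I)
  DU_dirac : ∀ I, ∀ i ∉ I, ∀ᵐ ω ∂(DU I), p i ω = 0

/-- Critical value functions `ρ : [0,1] → [0,1]`; only the values on `[0,1]` matter. -/
structure IsCriticalValueFunction (ρ : ℝ → ℝ) : Prop where
  mapsTo : MapsTo ρ (Icc 0 1) (Icc 0 1)
  monotoneOn : MonotoneOn ρ (Icc 0 1)
  continuousOn : ContinuousOn ρ (Icc 0 1)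
  map_zero : ρ 0 = 0
  pos : ∀ u ∈ Ioc (0 : ℝ) 1, 0 < ρ u

/-- The rejection curve `r(x) = inf {u ∈ [0,1] : ρ(u) = x}` of `ρ`, with `inf ∅ = ∞`. -/
def rejectionCurve (ρ : ℝ → ℝ) (x : ℝ) : EReal :=
  ⨅ u ∈ {u : ℝ | u ∈ Icc (0 : ℝ) 1 ∧ ρ u = x}, (u : EReal)

/-- The asymptotically optimal rejection curve `f_α(t) = t / (t (1 - α) + α)`. -/
def aorc (α t : ℝ) : ℝ := t / (t * (1 - α) + α)

/-- The critical values `α_{j:n} = ρ(j/n)`, `j = 1, …, n`. -/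
def critValue (ρ : ℝ → ℝ) (n j : ℕ) : ℝ := ρ ((j : ℝ) / n)

/-- The `j`-th smallest, `1 ≤ j ≤ n`, of the numbers `x i`, `i < n`. -/
def orderStat (x : ℕ → ℝ) (n j : ℕ) : ℝ :=
  if h : j - 1 < n then
    x (Tuple.sort (fun i : Fin n => x i) ⟨j - 1, h⟩)
  else 0

/-- `λ_n(λ) = inf {j ∈ {1, …, n} : α_{j:n} ≥ λ}`, where `inf ∅ = n`. -/
def sudOrder (ρ : ℝ → ℝ) (lam : ℝ) (n : ℕ) : ℕ :=
  sInf (insert n {j : ℕ | 1 ≤ j ∧ j ≤ n ∧ lam ≤ critValue ρ n j})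

open scoped Classical in
/-- The index `m_n` of the step-up-down procedure of order `ℓ`; the value `0` (the supremum of
the empty set of natural numbers) means that nothing is rejected. -/
def sudIndex (ρ : ℝ → ℝ) (n ℓ : ℕ) (x : ℕ → ℝ) : ℕ :=
  if orderStat x n ℓ ≤ critValue ρ n ℓ then
    sSup {j : ℕ | ℓ ≤ j ∧ j ≤ n ∧ ∀ i, ℓ ≤ i → i ≤ j → orderStat x n i ≤ critValue ρ n i}
  else
    sSup {j : ℕ | 1 ≤ j ∧ j ≤ ℓ ∧ orderStat x n j ≤ critValue ρ n j}

open scoped Classical in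
/-- The set of hypotheses among the first `n` that are rejected by the step-up-down procedure of
order `ℓ` based on `ρ`, when the p-values are `x`. -/
def sudRejected (ρ : ℝ → ℝ) (n ℓ : ℕ) (x : ℕ → ℝ) : Finset ℕ :=
  (Finset.range n).filter fun i =>
    1 ≤ sudIndex ρ n ℓ x ∧ x i ≤ critValue ρ n (sudIndex ρ n ℓ x)

open scoped Classical in
/-- The number `n_0(n)` of indices in `I` among the first `n`. -/
def numTrue (I : Set ℕ) (n : ℕ) : ℕ := ((Finset.range n).filter fun i => i ∈ I).card

/-- `ζ_n = n_0(n) / n`. -/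
def propTrue (I : Set ℕ) (n : ℕ) : ℝ := (numTrue I n : ℝ) / n

namespace Model

variable {Θ Ω : Type*} [MeasurableSpace Ω]

/-- `I_0(ϑ)`, the index set of the true null hypotheses. -/
def trueNulls (M : Model Θ Ω) (ϑ : Θ) : Set ℕ := {i | ϑ ∈ M.H i}

/-- The number `R_n` of rejections of the step-up-down procedure of order `ℓ` based on `ρ`. -/
def numRej (M : Model Θ Ω) (ρ : ℝ → ℝ) (n ℓ : ℕ) (ω : Ω) : ℕ :=
  (sudRejected ρ n ℓ fun i => M.p i ω).card

open scoped Classical in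
/-- The number `V_n` of false rejections of the step-up-down procedure of order `ℓ` based on `ρ`,
when `I` is the index set of the true hypotheses. -/
def numFalseRej (M : Model Θ Ω) (I : Set ℕ) (ρ : ℝ → ℝ) (n ℓ : ℕ) (ω : Ω) : ℕ :=
  ((sudRejected ρ n ℓ fun i => M.p i ω).filter fun i => i ∈ I).card

/-- The expected false discovery proportion under `μ`, when `I` is the index set of the true
hypotheses. -/
def expFDP (M : Model Θ Ω) (μ : Measure Ω) (I : Set ℕ) (ρ : ℝ → ℝ) (n ℓ : ℕ) : ℝ :=
  ∫ ω, (M.numFalseRej I ρ n ℓ ω : ℝ) / max (M.numRej ρ n ℓ ω : ℝ) 1 ∂μ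

/-- `FDR_ϑ` of the step-up-down procedure of order `ℓ` based on `ρ`. -/
def FDR (M : Model Θ Ω) (ϑ : Θ) (ρ : ℝ → ℝ) (n ℓ : ℕ) : ℝ :=
  M.expFDP (M.P ϑ) (M.trueNulls ϑ) ρ n ℓ

/-- `FDR_{I}`, the false discovery rate under the Dirac-uniform configuration `DU I`. -/
def FDRDU (M : Model Θ Ω) (I : Set ℕ) (ρ : ℝ → ℝ) (n ℓ : ℕ) : ℝ :=
  M.expFDP (M.DU I) I ρ n ℓ

/-- The power `E_ϑ[(R_n - V_n) / (n_1 ∨ 1)]`, where `n_1 = n - n_0`. -/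
def power (M : Model Θ Ω) (ϑ : Θ) (ρ : ℝ → ℝ) (n ℓ : ℕ) : ℝ :=
  ∫ ω, ((M.numRej ρ n ℓ ω : ℝ) - M.numFalseRej (M.trueNulls ϑ) ρ n ℓ ω) /
    max ((n : ℝ) - numTrue (M.trueNulls ϑ) n) 1 ∂(M.P ϑ)

/-- The asymptotic Dirac-uniform FDR along `I` of the step-up-down procedure of order `λ_n(λ)`
based on `ρ` does not exceed the asymptotic supremum of its FDR over the model. -/
def DULeSup (M : Model Θ Ω) (lam : ℝ) (ρ : ℝ → ℝ) (I : Set ℕ) : Prop :=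
  limsup (fun n => M.FDRDU I ρ n (sudOrder ρ lam n)) atTop ≤
    limsup (fun n => ⨆ ϑ, M.FDR ϑ ρ n (sudOrder ρ lam n)) atTop

/-- The class `M_λ` of rejection curves, each of them represented by its critical value function
(a critical value function on `[0,1]` and its rejection curve determine each other). -/
def curveClass (M : Model Θ Ω) (α lam : ℝ) : Set (ℝ → ℝ) :=
  {ρ | IsCriticalValueFunction ρ ∧
    ∀ (I : Set ℕ) (ζ : ℝ), ζ ∈ Icc (0 : ℝ) 1 → Tendsto (propTrue I) atTop (𝓝 ζ) →
      M.DULeSup lam ρ I ∧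
      limsup (fun n => ⨆ ϑ, M.FDR ϑ ρ n (sudOrder ρ lam n)) atTop ≤ α}

/-- The p-values of true hypotheses are uniformly distributed on `[0,1]`. -/
def NullUniform (M : Model Θ Ω) : Prop :=
  ∀ ϑ, ∀ i ∈ M.trueNulls ϑ, (M.P ϑ).map (M.p i) = volume.restrict (Icc (0 : ℝ) 1)

/-- The p-values of the true hypotheses are i.i.d. -/
def NullIID (M : Model Θ Ω) : Prop :=
  ∀ ϑ, iIndepFun (fun i : M.trueNulls ϑ => M.p i) (M.P ϑ) ∧
    ∀ i ∈ M.trueNulls ϑ, ∀ j ∈ M.trueNulls ϑ, IdentDistrib (M.p i) (M.p j) (M.P ϑ) (M.P ϑ)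

/-- For every `n`, the p-values of the true hypotheses among the first `n` and those of the
false hypotheses among the first `n` are independent random vectors. -/
def NullIndepAlt (M : Model Θ Ω) : Prop :=
  ∀ ϑ, ∀ n : ℕ, IndepFun
    (fun ω (i : {i : ℕ // i < n ∧ i ∈ M.trueNulls ϑ}) => M.p i ω)
    (fun ω (i : {i : ℕ // i < n ∧ i ∉ M.trueNulls ϑ}) => M.p i ω) (M.P ϑ)

/-- The parameters `ϑ` with `liminf ζ_n(ϑ) > α / (κ (1 - α) + α)`. -/
def paramSet (M : Model Θ Ω) (α κ : ℝ) : Set Θ :=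
  {ϑ | α / (κ * (1 - α) + α) < liminf (propTrue (M.trueNulls ϑ)) atTop}

end Model

end MultipleTesting

end

open MultipleTesting

/-!
The empirical distribution function of the p-values under the Dirac-uniform configuration with
true hypotheses of density `ζ` is asymptotically the line `s ↦ 1 - ζ + ζ s`
(`exists_uniform_const`), and a step-up-down procedure that reaches the critical value `t` has
asymptotic false discovery proportion at least `ζ t / (1 - ζ + ζ t)` (`eventually_le_FDRDU`). This
proportion is `α` for `ζ = critDensity α t`, the density at which the line meets `aorc α` at `t`,
and it is strictly increasing in `ζ`. So if a rejection curve lies strictly below `aorc α` at `t`,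
then for a density slightly above `critDensity α t` the line is still above the curve at `t`, and
if the procedure gets as far as `t` its asymptotic false discovery rate exceeds `α`
(`false_of_lt_line`). The procedure gets there

* if `t ≤ λ`, because up to its order it is of step-up type;
* if the curve is below `aorc α` between `λ` and `t`, because by concavity `aorc α` is below the
  line there;
* if the line and the curve meet at most once, because a dip of the line below the curve before
  `t` would, for a slightly larger density, produce two intersections.

For the infimum over the class of step-up curves it remains to see that `aorc α` truncated at
`κ < 1` belongs to the class. Under independence the false discovery rate of a step-up procedure
is at most `∑ E[ρ(m_i / n) / m_i]` over the true hypotheses `i`, where `m_i` is the index after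
replacing `p_i` by `0` (`FDR_le_sum_integral`). By the uniform law of large numbers the proportion
of true hypotheses is asymptotically at most `(1 - u) / (1 - ρ u)` when `m_i / n = u`, and for the
critical value function of `aorc α` this times `ρ u / u` is at most `α` (`FDR_truncCritFun_le`).
The error terms are uniform in the parameter because the law of large numbers is quantitative.

For the comparison of powers, every `ρ` in the class satisfies `ρ 1 < 1` and lies below the
critical value function of `aorc α`. When the proportion of true hypotheses stays above
`critDensity α κ`, this and the law of large numbers force the critical value used by the step-up
procedure to be less than `κ` with probability `1 - O(1 / n)`, and on that range `ρf` is at least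
`ρ`, so every hypothesis rejected with `ρ` is rejected with `ρf` (`numFalseRej_mono`).
-/

namespace MultipleTesting

/-! ### Counting p-values and the index of a step-up-down procedure -/

open scoped Classical in
/-- The number of indices `i < n` in `I` with `x i ≤ s`, an unnormalized empirical distribution
function. -/
noncomputable def countLE (I : Set ℕ) (x : ℕ → ℝ) (n : ℕ) (s : ℝ) : ℕ :=
  ((Finset.range n).filter fun i => i ∈ I ∧ x i ≤ s).card

theorem countLE_mono (I : Set ℕ) (x : ℕ → ℝ) (n : ℕ) {s t : ℝ} (h : s ≤ t) :
    countLE I x n s ≤ countLE I x n t := by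
  classical
  unfold countLE
  refine Finset.card_le_card fun i hi => ?_
  simp only [Finset.mem_filter] at hi ⊢
  exact ⟨hi.1, hi.2.1, hi.2.2.trans h⟩

theorem countLE_le (I : Set ℕ) (x : ℕ → ℝ) (n : ℕ) (s : ℝ) : countLE I x n s ≤ n := by
  classical
  unfold countLE
  exact (Finset.card_filter_le _ _).trans (by simp)

theorem numTrue_le (I : Set ℕ) (n : ℕ) : numTrue I n ≤ n := by
  classical
  unfold numTrue
  exact (Finset.card_filter_le _ _).trans (by simp)

theorem numTrue_add_compl (I : Set ℕ) (n : ℕ) : numTrue I n + numTrue Iᶜ n = n := by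
  classical
  have h := Finset.card_filter_add_card_filter_not (s := Finset.range n) (fun i => i ∈ I)
  rw [Finset.card_range] at h
  refine Eq.trans ?_ h
  unfold numTrue
  congr 2
  ext i
  simp

theorem countLE_univ (I : Set ℕ) (x : ℕ → ℝ) (n : ℕ) (s : ℝ) :
    countLE univ x n s = countLE I x n s + countLE Iᶜ x n s := by
  classical
  unfold countLE
  rw [← Finset.card_union_of_disjoint]
  · congr 1
    ext i
    simp only [Finset.mem_filter, Finset.mem_union, mem_univ, true_and, mem_compl_iff]
    tauto
  · refine Finset.disjoint_left.2 fun i hi hi' => ?_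
    simp only [Finset.mem_filter] at hi hi'
    exact hi'.2.1 hi.2.1

theorem countLE_le_numTrue (I : Set ℕ) (x : ℕ → ℝ) (n : ℕ) (s : ℝ) :
    countLE I x n s ≤ numTrue I n := by
  classical
  unfold countLE numTrue
  refine Finset.card_le_card fun i hi => ?_
  simp only [Finset.mem_filter] at hi ⊢
  exact ⟨hi.1, hi.2.1⟩

theorem countLE_eq_numTrue {I : Set ℕ} {x : ℕ → ℝ} {n : ℕ} {s : ℝ}
    (h : ∀ i ∈ I, i < n → x i ≤ s) : countLE I x n s = numTrue I n := by
  classical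
  unfold countLE numTrue
  congr 1
  ext i
  simp only [Finset.mem_filter, Finset.mem_range]
  exact ⟨fun hi => ⟨hi.1, hi.2.1⟩, fun hi => ⟨hi.1, hi.2, h i hi.2 hi.1⟩⟩

theorem numTrue_univ (n : ℕ) : numTrue univ n = n := by
  classical
  unfold numTrue
  simp

theorem orderStat_le_iff (x : ℕ → ℝ) {n j : ℕ} (h1 : 1 ≤ j) (hj : j ≤ n) (c : ℝ) :
    orderStat x n j ≤ c ↔ j ≤ countLE univ x n c := by
  classical
  have hlt : j - 1 < n := by omega
  unfold orderStat
  rw [dif_pos hlt]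
  set f : Fin n → ℝ := fun i => x i
  have hm := Tuple.monotone_sort f
  have key := Tuple.lt_card_le_iff_apply_le_of_monotone (a := c) (j := ⟨j - 1, hlt⟩) hm
  have hcard : (Finset.univ.filter fun i => (f ∘ Tuple.sort f) i ≤ c).card
      = countLE univ x n c := by
    have h2 : (Finset.univ.filter fun i => (f ∘ Tuple.sort f) i ≤ c).card
        = (Finset.univ.filter fun i => f i ≤ c).card :=
      Finset.card_equiv (Tuple.sort f) (by simp)
    rw [h2]
    unfold countLE
    refine Finset.card_bij (fun i _ => (i : ℕ)) ?_ ?_ ?_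
    · intro a ha
      simpa [f] using ha
    · intro a _ b _ hab
      exact Fin.ext hab
    · intro b hb
      simp only [Finset.mem_filter, Finset.mem_range] at hb
      exact ⟨⟨b, hb.1⟩, by simpa [f] using hb.2.2, rfl⟩
  rw [hcard] at key
  simp only [Function.comp] at key
  change f _ ≤ c ↔ _
  rw [← key]
  omega

/-- If `p_{i:n} ≤ α_{i:n}` for all `i` from some `a ≤ ℓ` up to `j`, the index is at least `j`,
whether the order `ℓ` is at most `j` or larger. -/
theorem le_sudIndex {ρ : ℝ → ℝ} {x : ℕ → ℝ} {n l j a : ℕ} (hl1 : 1 ≤ l) (hln : l ≤ n)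
    (hj1 : 1 ≤ j) (hjn : j ≤ n) (hal : a ≤ l) (haj : a ≤ j)
    (h : ∀ i, 1 ≤ i → a ≤ i → i ≤ j → i ≤ countLE univ x n (critValue ρ n i)) :
    j ≤ sudIndex ρ n l x := by
  classical
  unfold sudIndex
  split_ifs with hc
  · have hbdd : BddAbove {j : ℕ | l ≤ j ∧ j ≤ n ∧
        ∀ i, l ≤ i → i ≤ j → orderStat x n i ≤ critValue ρ n i} := ⟨n, fun k hk => hk.2.1⟩
    rcases le_total l j with hlj | hjl
    · refine le_csSup hbdd ⟨hlj, hjn, fun i hi1 hi2 => ?_⟩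
      exact (orderStat_le_iff x (hl1.trans hi1) (hi2.trans hjn) _).2
        (h i (hl1.trans hi1) (hal.trans hi1) hi2)
    · refine hjl.trans (le_csSup hbdd ⟨le_rfl, hln, fun i hi1 hi2 => ?_⟩)
      rw [le_antisymm hi2 hi1]
      exact hc
  · have hjl : j ≤ l := by
      by_contra hlj
      push Not at hlj
      exact hc ((orderStat_le_iff x hl1 hln _).2 (h l hl1 hal hlj.le))
    refine le_csSup ⟨l, fun k hk => hk.2.1⟩ ⟨hj1, hjl, ?_⟩
    exact (orderStat_le_iff x hj1 hjn _).2 (h j hj1 haj le_rfl)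

theorem sudIndex_le {ρ : ℝ → ℝ} {x : ℕ → ℝ} {n l : ℕ} (hln : l ≤ n) :
    sudIndex ρ n l x ≤ n := by
  classical
  unfold sudIndex
  split_ifs with hc
  · refine csSup_le ⟨l, le_rfl, hln, fun i hi1 hi2 => ?_⟩ fun j hj => hj.2.1
    rw [le_antisymm hi2 hi1]
    exact hc
  · rcases Set.eq_empty_or_nonempty
      {j : ℕ | 1 ≤ j ∧ j ≤ l ∧ orderStat x n j ≤ critValue ρ n j} with he | hne
    · rw [he]
      simp
    · exact csSup_le hne fun j hj => hj.2.1.trans hln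

theorem sudIndex_self_le_countLE {ρ : ℝ → ℝ} {x : ℕ → ℝ} {n : ℕ}
    (hm : 1 ≤ sudIndex ρ n n x) :
    sudIndex ρ n n x ≤ countLE univ x n (critValue ρ n (sudIndex ρ n n x)) := by
  classical
  have hle : sudIndex ρ n n x ≤ n := sudIndex_le le_rfl
  rw [← orderStat_le_iff x hm hle]
  revert hm hle
  unfold sudIndex
  split_ifs with hc
  · intro hm hle
    have hne : {j : ℕ | n ≤ j ∧ j ≤ n ∧
        ∀ i, n ≤ i → i ≤ j → orderStat x n i ≤ critValue ρ n i}.Nonempty := by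
      refine ⟨n, le_rfl, le_rfl, fun i hi1 hi2 => ?_⟩
      rw [le_antisymm hi2 hi1]
      exact hc
    have hmem := Nat.sSup_mem hne ⟨n, fun k hk => hk.2.1⟩
    exact hmem.2.2 _ hmem.1 le_rfl
  · intro hm hle
    have hne : {j : ℕ | 1 ≤ j ∧ j ≤ n ∧ orderStat x n j ≤ critValue ρ n j}.Nonempty := by
      by_contra he
      rw [Set.not_nonempty_iff_eq_empty] at he
      rw [he] at hm
      simp at hm
    exact (Nat.sSup_mem hne ⟨n, fun k hk => hk.2.1⟩).2.2

theorem le_sudIndex_self {ρ : ℝ → ℝ} {x : ℕ → ℝ} {n j : ℕ} (hj1 : 1 ≤ j) (hjn : j ≤ n)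
    (h : j ≤ countLE univ x n (critValue ρ n j)) : j ≤ sudIndex ρ n n x :=
  le_sudIndex (a := j) (hj1.trans hjn) le_rfl hj1 hjn hjn le_rfl fun i _ hi1 hi2 => by
    rw [le_antisymm hi2 hi1]
    exact h

theorem natCast_div_mem {k n : ℕ} (hk : k ≤ n) : (k : ℝ) / n ∈ Icc (0 : ℝ) 1 :=
  ⟨by positivity, div_le_one_of_le₀ (by exact_mod_cast hk) (by positivity)⟩

theorem critValue_mono {ρ : ℝ → ℝ} (hρ : IsCriticalValueFunction ρ) {n i j : ℕ} (hij : i ≤ j)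
    (hjn : j ≤ n) : critValue ρ n i ≤ critValue ρ n j := by
  refine hρ.monotoneOn (natCast_div_mem (hij.trans hjn)) (natCast_div_mem hjn) ?_
  gcongr

theorem critValue_mem {ρ : ℝ → ℝ} (hρ : IsCriticalValueFunction ρ) {n j : ℕ} (hjn : j ≤ n) :
    critValue ρ n j ∈ Icc (0 : ℝ) 1 := hρ.mapsTo (natCast_div_mem hjn)

theorem critValue_pos {ρ : ℝ → ℝ} (hρ : IsCriticalValueFunction ρ) {n j : ℕ} (hj : 1 ≤ j)
    (hjn : j ≤ n) : 0 < critValue ρ n j :=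
  hρ.pos _ ⟨div_pos (by exact_mod_cast hj) (by exact_mod_cast hj.trans hjn), (natCast_div_mem hjn).2⟩

/-- A step-up procedure rejects exactly `m_n` hypotheses. -/
theorem countLE_critValue_sudIndex_self {ρ : ℝ → ℝ} (hρ : IsCriticalValueFunction ρ) {x : ℕ → ℝ}
    {n : ℕ} (hm : 1 ≤ sudIndex ρ n n x) :
    countLE univ x n (critValue ρ n (sudIndex ρ n n x)) = sudIndex ρ n n x := by
  refine le_antisymm ?_ (sudIndex_self_le_countLE hm)
  have h1 := sudIndex_self_le_countLE hm
  have h2 := countLE_le univ x n (critValue ρ n (sudIndex ρ n n x))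
  exact le_sudIndex_self (hm.trans h1) h2 (countLE_mono _ _ _ (critValue_mono hρ h1 h2))

theorem mem_sudRejected {ρ : ℝ → ℝ} {n l : ℕ} {x : ℕ → ℝ} {i : ℕ} :
    i ∈ sudRejected ρ n l x ↔
      i < n ∧ 1 ≤ sudIndex ρ n l x ∧ x i ≤ critValue ρ n (sudIndex ρ n l x) := by
  classical
  unfold sudRejected
  simp

theorem card_sudRejected {ρ : ℝ → ℝ} {n l : ℕ} {x : ℕ → ℝ} (h : 1 ≤ sudIndex ρ n l x) :
    (sudRejected ρ n l x).card = countLE univ x n (critValue ρ n (sudIndex ρ n l x)) := by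
  classical
  unfold countLE
  congr 1
  ext i
  simp [mem_sudRejected, h]

theorem sudRejected_eq_empty {ρ : ℝ → ℝ} {n l : ℕ} {x : ℕ → ℝ} (h : ¬ 1 ≤ sudIndex ρ n l x) :
    sudRejected ρ n l x = ∅ := by
  ext i
  simp [mem_sudRejected, h]

/-- Setting the p-value of a rejected hypothesis to `0` does not change the index of a step-up
procedure. -/
theorem sudIndex_self_update {ρ : ℝ → ℝ} (hρ : IsCriticalValueFunction ρ) {n i : ℕ} {x : ℕ → ℝ}
    (hx : 0 ≤ x i) (hi : i ∈ sudRejected ρ n n x) :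
    sudIndex ρ n n (Function.update x i 0) = sudIndex ρ n n x := by
  classical
  obtain ⟨hin, hm, hle⟩ := mem_sudRejected.1 hi
  set y := Function.update x i 0
  have hmn : sudIndex ρ n n x ≤ n := sudIndex_le le_rfl
  have hmn' : sudIndex ρ n n y ≤ n := sudIndex_le le_rfl
  have hcount : ∀ s, x i ≤ s → countLE univ y n s = countLE univ x n s := by
    intro s hs
    unfold countLE
    congr 1
    ext k
    simp only [Finset.mem_filter]
    by_cases hk : k = i
    · subst hk
      simp [y, hs, hx.trans hs]
    · simp [y, hk]
  have h1 : sudIndex ρ n n x ≤ sudIndex ρ n n y := by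
    refine le_sudIndex_self hm hmn ?_
    rw [hcount _ hle]
    exact sudIndex_self_le_countLE hm
  refine le_antisymm ?_ h1
  refine le_sudIndex_self (hm.trans h1) hmn' ?_
  rw [← hcount _ (hle.trans (critValue_mono hρ h1 hmn'))]
  exact sudIndex_self_le_countLE (hm.trans h1)

theorem one_le_sudIndex_self_update {ρ : ℝ → ℝ} (hρ : IsCriticalValueFunction ρ) {n i : ℕ}
    (hin : i < n) (x : ℕ → ℝ) : 1 ≤ sudIndex ρ n n (Function.update x i 0) := by
  classical
  refine le_sudIndex_self le_rfl (by omega) ?_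
  unfold countLE
  refine Finset.card_pos.2 ⟨i, ?_⟩
  simp [hin, (critValue_pos hρ (n := n) le_rfl (by omega)).le]

theorem countLE_update_le {n i : ℕ} (x : ℕ → ℝ) (s : ℝ) :
    countLE univ (Function.update x i 0) n s ≤ countLE univ x n s + 1 := by
  classical
  unfold countLE
  refine le_trans (Finset.card_le_card ?_) (Finset.card_insert_le i _)
  intro k hk
  by_cases hki : k = i
  · simp [hki]
  · simpa [hki] using hk

theorem sudOrder_mem {ρ : ℝ → ℝ} {lam : ℝ} {n : ℕ} :
    sudOrder ρ lam n = n ∨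
      (1 ≤ sudOrder ρ lam n ∧ sudOrder ρ lam n ≤ n ∧ lam ≤ critValue ρ n (sudOrder ρ lam n)) := by
  have h := Nat.sInf_mem (s := insert n {j : ℕ | 1 ≤ j ∧ j ≤ n ∧ lam ≤ critValue ρ n j})
    (Set.insert_nonempty _ _)
  exact h

theorem one_le_sudOrder {ρ : ℝ → ℝ} {lam : ℝ} {n : ℕ} (hn : 1 ≤ n) : 1 ≤ sudOrder ρ lam n := by
  rcases sudOrder_mem (ρ := ρ) (lam := lam) (n := n) with h | h
  · rwa [h]
  · exact h.1

theorem sudOrder_le {ρ : ℝ → ℝ} {lam : ℝ} {n : ℕ} : sudOrder ρ lam n ≤ n := by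
  rcases sudOrder_mem (ρ := ρ) (lam := lam) (n := n) with h | h
  · exact h.le
  · exact h.2.1

/-! ### Measurability -/

section Measurability

variable {Ω : Type*} [MeasurableSpace Ω]

theorem countLE_eq_sum (I : Set ℕ) (x : ℕ → ℝ) (n : ℕ) (s : ℝ) [DecidablePred (· ∈ I)] :
    countLE I x n s = ∑ i ∈ (Finset.range n).filter (· ∈ I), if x i ≤ s then 1 else 0 := by
  classical
  unfold countLE
  rw [← Finset.sum_filter, Finset.filter_filter, Finset.card_eq_sum_ones]
  congr

theorem measurable_countLE {p : ℕ → Ω → ℝ} (hp : ∀ i, Measurable (p i)) (I : Set ℕ) (n : ℕ)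
    (s : ℝ) : Measurable fun ω => countLE I (fun i => p i ω) n s := by
  classical
  simp_rw [countLE_eq_sum]
  exact Finset.measurable_sum _ fun i _ =>
    Measurable.ite (measurableSet_le (hp i) measurable_const) measurable_const measurable_const

theorem sudIndex_congr {ρ : ℝ → ℝ} {n l : ℕ} {x y : ℕ → ℝ} (hl1 : 1 ≤ l) (hln : l ≤ n)
    (h : ∀ j, 1 ≤ j → j ≤ n →
      (orderStat x n j ≤ critValue ρ n j ↔ orderStat y n j ≤ critValue ρ n j)) :
    sudIndex ρ n l x = sudIndex ρ n l y := by
  classical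
  have e1 : {j : ℕ | l ≤ j ∧ j ≤ n ∧ ∀ i, l ≤ i → i ≤ j → orderStat x n i ≤ critValue ρ n i} =
      {j : ℕ | l ≤ j ∧ j ≤ n ∧ ∀ i, l ≤ i → i ≤ j → orderStat y n i ≤ critValue ρ n i} := by
    ext j
    refine and_congr_right fun _ => and_congr_right fun h2 => forall_congr' fun i =>
      forall_congr' fun h3 => forall_congr' fun h4 => h i (hl1.trans h3) (h4.trans h2)
  have e2 : {j : ℕ | 1 ≤ j ∧ j ≤ l ∧ orderStat x n j ≤ critValue ρ n j} =
      {j : ℕ | 1 ≤ j ∧ j ≤ l ∧ orderStat y n j ≤ critValue ρ n j} := by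
    ext j
    exact and_congr_right fun h1 => and_congr_right fun h2 => h j h1 (h2.trans hln)
  unfold sudIndex
  rw [e1, e2]
  exact if_congr (h l hl1 hln) rfl rfl

/-- The index of the procedure is determined by the finitely many events
`p_{j:n} ≤ α_{j:n}`. -/
theorem measurable_sudIndex {p : ℕ → Ω → ℝ} (hp : ∀ i, Measurable (p i)) (ρ : ℝ → ℝ) {n l : ℕ}
    (hl1 : 1 ≤ l) (hln : l ≤ n) : Measurable fun ω => sudIndex ρ n l fun i => p i ω := by
  set D : Ω → Fin (n + 1) → Prop := fun ω j =>
    (j : ℕ) ≤ countLE univ (fun i => p i ω) n (critValue ρ n j) with hD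
  have hDm : Measurable D := measurable_pi_lambda _ fun j => measurableSet_setOfPred.1
    (measurableSet_le measurable_const (measurable_countLE hp _ _ _))
  have hfac : ∀ ω ω', D ω = D ω' →
      sudIndex ρ n l (fun i => p i ω) = sudIndex ρ n l (fun i => p i ω') := by
    intro ω ω' h
    refine sudIndex_congr hl1 hln fun j hj1 hjn => ?_
    rw [orderStat_le_iff _ hj1 hjn, orderStat_le_iff _ hj1 hjn]
    exact iff_of_eq (congrFun h ⟨j, by omega⟩)
  refine measurable_to_countable' fun k => ?_
  have : (fun ω => sudIndex ρ n l fun i => p i ω) ⁻¹' {k} =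
      D ⁻¹' (D '' ((fun ω => sudIndex ρ n l fun i => p i ω) ⁻¹' {k})) := by
    refine Subset.antisymm (subset_preimage_image _ _) ?_
    rintro ω ⟨ω', h1, h2⟩
    exact (hfac _ _ h2).symm.trans h1
  rw [this]
  exact hDm (Set.to_countable _).measurableSet

theorem measurable_countLE_critValue {p : ℕ → Ω → ℝ} (hp : ∀ i, Measurable (p i)) (I : Set ℕ)
    (ρ : ℝ → ℝ) {n l : ℕ} (hl1 : 1 ≤ l) (hln : l ≤ n) :
    Measurable fun ω => countLE I (fun i => p i ω) n
      (critValue ρ n (sudIndex ρ n l fun i => p i ω)) := by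
  have h : Measurable fun z : ℕ × Ω => countLE I (fun i => p i z.2) n (critValue ρ n z.1) :=
    measurable_from_prod_countable_right fun k => measurable_countLE hp I n (critValue ρ n k)
  exact h.comp ((measurable_sudIndex hp ρ hl1 hln).prodMk measurable_id)

end Measurability

namespace Model

variable {Θ Ω : Type*} [MeasurableSpace Ω] (M : Model Θ Ω)

theorem numFalseRej_eq (I : Set ℕ) (ρ : ℝ → ℝ) (n l : ℕ) (ω : Ω) :
    M.numFalseRej I ρ n l ω = if 1 ≤ sudIndex ρ n l (fun i => M.p i ω) then
      countLE I (fun i => M.p i ω) n (critValue ρ n (sudIndex ρ n l fun i => M.p i ω)) else 0 := by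
  classical
  split_ifs with h
  · unfold numFalseRej countLE
    congr 1
    ext i
    simp only [Finset.mem_filter, mem_sudRejected, Finset.mem_range]
    tauto
  · unfold numFalseRej
    rw [sudRejected_eq_empty h]
    simp

theorem numRej_eq (ρ : ℝ → ℝ) (n l : ℕ) (ω : Ω) :
    M.numRej ρ n l ω = M.numFalseRej univ ρ n l ω := by
  classical
  unfold numRej numFalseRej
  simp

theorem numRej_eq_add (I : Set ℕ) (ρ : ℝ → ℝ) (n l : ℕ) (ω : Ω) :
    M.numRej ρ n l ω = M.numFalseRej I ρ n l ω + M.numFalseRej Iᶜ ρ n l ω := by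
  rw [numRej_eq, numFalseRej_eq, numFalseRej_eq, numFalseRej_eq]
  split_ifs
  · exact countLE_univ _ _ _ _
  · rfl

theorem numFalseRej_le_numTrue (I : Set ℕ) (ρ : ℝ → ℝ) (n l : ℕ) (ω : Ω) :
    M.numFalseRej I ρ n l ω ≤ numTrue I n := by
  rw [numFalseRej_eq]
  split_ifs
  · exact countLE_le_numTrue _ _ _ _
  · exact Nat.zero_le _

theorem measurable_numFalseRej (I : Set ℕ) (ρ : ℝ → ℝ) {n l : ℕ} (hl1 : 1 ≤ l) (hln : l ≤ n) :
    Measurable (M.numFalseRej I ρ n l) := by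
  have h : M.numFalseRej I ρ n l = _ := funext fun ω => M.numFalseRej_eq I ρ n l ω
  rw [h]
  refine Measurable.ite ?_ (measurable_countLE_critValue M.p_measurable I ρ hl1 hln)
    measurable_const
  exact measurableSet_le measurable_const (measurable_sudIndex M.p_measurable ρ hl1 hln)

theorem measurable_numRej (ρ : ℝ → ℝ) {n l : ℕ} (hl1 : 1 ≤ l) (hln : l ≤ n) :
    Measurable (M.numRej ρ n l) := by
  have h : M.numRej ρ n l = _ := funext fun ω => M.numRej_eq ρ n l ω
  rw [h]
  exact M.measurable_numFalseRej univ ρ hl1 hln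

/-- The false discovery proportion `V_n / (R_n ∨ 1)`. -/
noncomputable def fdp (I : Set ℕ) (ρ : ℝ → ℝ) (n l : ℕ) (ω : Ω) : ℝ :=
  (M.numFalseRej I ρ n l ω : ℝ) / max (M.numRej ρ n l ω : ℝ) 1

theorem fdp_nonneg (I : Set ℕ) (ρ : ℝ → ℝ) (n l : ℕ) (ω : Ω) : 0 ≤ M.fdp I ρ n l ω := by
  unfold fdp
  positivity

theorem fdp_le_one (I : Set ℕ) (ρ : ℝ → ℝ) (n l : ℕ) (ω : Ω) : M.fdp I ρ n l ω ≤ 1 := by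
  unfold fdp
  refine div_le_one_of_le₀ (le_max_of_le_left ?_) (by positivity)
  rw [M.numRej_eq_add I]
  push_cast
  linarith [(Nat.cast_nonneg (M.numFalseRej Iᶜ ρ n l ω) : (0 : ℝ) ≤ _)]

theorem measurable_fdp (I : Set ℕ) (ρ : ℝ → ℝ) {n l : ℕ} (hl1 : 1 ≤ l) (hln : l ≤ n) :
    Measurable (M.fdp I ρ n l) := by
  have h1 : Measurable fun ω => (M.numFalseRej I ρ n l ω : ℝ) :=
    measurable_from_top.comp (M.measurable_numFalseRej I ρ hl1 hln)
  have h2 : Measurable fun ω => (M.numRej ρ n l ω : ℝ) :=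
    measurable_from_top.comp (M.measurable_numRej ρ hl1 hln)
  exact h1.div (h2.max measurable_const)

theorem integrable_fdp (μ : Measure Ω) [IsProbabilityMeasure μ] (I : Set ℕ) (ρ : ℝ → ℝ) {n l : ℕ}
    (hl1 : 1 ≤ l) (hln : l ≤ n) : Integrable (M.fdp I ρ n l) μ := by
  refine Integrable.of_bound (M.measurable_fdp I ρ hl1 hln).aestronglyMeasurable 1
    (ae_of_all _ fun ω => ?_)
  rw [Real.norm_of_nonneg (M.fdp_nonneg I ρ n l ω)]
  exact M.fdp_le_one I ρ n l ω

theorem expFDP_le_one (μ : Measure Ω) [IsProbabilityMeasure μ] (I : Set ℕ) (ρ : ℝ → ℝ) (n l : ℕ) :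
    M.expFDP μ I ρ n l ≤ 1 := by
  have h := integral_mono_of_nonneg (μ := μ) (ae_of_all _ fun ω => M.fdp_nonneg I ρ n l ω)
    (integrable_const (1 : ℝ)) (ae_of_all _ fun ω => M.fdp_le_one I ρ n l ω)
  simpa [fdp, expFDP] using h

theorem expFDP_nonneg (μ : Measure Ω) (I : Set ℕ) (ρ : ℝ → ℝ) (n l : ℕ) :
    0 ≤ M.expFDP μ I ρ n l :=
  integral_nonneg fun ω => M.fdp_nonneg I ρ n l ω

end Model

/-! ### A uniform law of large numbers -/

theorem measureReal_le_of_uniform {Ω : Type*} [MeasurableSpace Ω] {μ : Measure Ω}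
    {X : Ω → ℝ} (hX : Measurable X)
    (hU : μ.map X = volume.restrict (Icc (0 : ℝ) 1)) {s : ℝ} (hs : s ∈ Icc (0 : ℝ) 1) :
    μ.real {ω | X ω ≤ s} = s := by
  have h1 : μ {ω | X ω ≤ s} = μ.map X (Iic s) := by
    rw [Measure.map_apply hX measurableSet_Iic]
    rfl
  rw [measureReal_def, h1, hU, Measure.restrict_apply measurableSet_Iic]
  have : Iic s ∩ Icc 0 1 = Icc 0 s := by
    ext y
    simp only [mem_inter_iff, mem_Iic, mem_Icc]
    exact ⟨fun h => ⟨h.2.1, h.1⟩, fun h => ⟨h.2, h.1, h.2.trans hs.2⟩⟩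
  rw [this, Real.volume_Icc, ENNReal.toReal_ofReal] <;> linarith [hs.1]

section LLN

variable {Ω : Type*} [MeasurableSpace Ω] {μ : Measure Ω} [IsProbabilityMeasure μ]
  {p : ℕ → Ω → ℝ} {I : Set ℕ}

theorem countLE_concentration (hp : ∀ i, Measurable (p i))
    (hU : ∀ i ∈ I, μ.map (p i) = volume.restrict (Icc (0 : ℝ) 1))
    (hI : iIndepFun (fun i : I => p i) μ) {s : ℝ} (hs : s ∈ Icc (0 : ℝ) 1) (n : ℕ) {c : ℝ}
    (hc : 0 < c) :
    μ.real {ω | c ≤ |(countLE I (fun i => p i ω) n s : ℝ) - numTrue I n * s|} ≤ n / c ^ 2 := by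
  classical
  set S := (Finset.range n).filter (· ∈ I) with hS
  set X : ℕ → Ω → ℝ := fun i ω => if p i ω ≤ s then 1 else 0 with hX
  have hXm : ∀ i, Measurable (X i) := fun i =>
    Measurable.ite (measurableSet_le (hp i) measurable_const) measurable_const measurable_const
  have hX01 : ∀ i ω, X i ω ∈ Icc (0 : ℝ) 1 := by
    intro i ω
    simp only [hX]
    split_ifs <;> simp
  have hL2 : ∀ i, MemLp (X i) 2 μ := fun i =>
    memLp_of_bounded (ae_of_all _ (hX01 i)) (hXm i).aestronglyMeasurable 2
  have hmean : ∀ i ∈ S, ∫ ω, X i ω ∂μ = s := by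
    intro i hi
    have : X i = {ω | p i ω ≤ s}.indicator 1 := by
      ext ω
      simp [hX, indicator_apply]
    rw [this, integral_indicator_one (measurableSet_le (hp i) measurable_const)]
    exact measureReal_le_of_uniform (hp i) (hU i (Finset.mem_filter.1 hi).2) hs
  have hind : Set.Pairwise (S : Set ℕ) fun i j => IndepFun (X i) (X j) μ := by
    intro i hi j hj hij
    have hi' : i ∈ I := (Finset.mem_filter.1 hi).2
    have hj' : j ∈ I := (Finset.mem_filter.1 hj).2
    have h := hI.indepFun (i := ⟨i, hi'⟩) (j := ⟨j, hj'⟩) (by simpa using hij)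
    have hφ : Measurable fun y : ℝ => if y ≤ s then (1 : ℝ) else 0 :=
      Measurable.ite measurableSet_Iic measurable_const measurable_const
    exact h.comp hφ hφ
  have hsum : ∀ ω, (countLE I (fun i => p i ω) n s : ℝ) = (∑ i ∈ S, X i) ω := by
    intro ω
    rw [countLE_eq_sum, Finset.sum_apply]
    push_cast
    rfl
  have hcard : (S.card : ℝ) = numTrue I n := by
    unfold numTrue
    congr
  have hE : ∫ ω, (∑ i ∈ S, X i) ω ∂μ = numTrue I n * s := by
    simp_rw [Finset.sum_apply]
    rw [integral_finsetSum _ fun i _ => (hL2 i).integrable (by norm_num),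
      Finset.sum_congr rfl hmean, Finset.sum_const, nsmul_eq_mul, hcard]
  have hV : variance (∑ i ∈ S, X i) μ ≤ n := by
    rw [IndepFun.variance_sum (fun i _ => hL2 i) hind]
    calc ∑ i ∈ S, variance (X i) μ ≤ ∑ i ∈ S, (1 : ℝ) := by
          refine Finset.sum_le_sum fun i _ => ?_
          refine (variance_le_sq_of_bounded (ae_of_all _ (hX01 i)) (hXm i).aemeasurable).trans ?_
          norm_num
      _ = numTrue I n := by simp [hcard]
      _ ≤ n := by exact_mod_cast numTrue_le I n
  have hcheb := meas_ge_le_variance_div_sq (memLp_finsetSum' S fun i _ => hL2 i) hc (μ := μ)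
  rw [hE] at hcheb
  simp_rw [hsum]
  rw [measureReal_def]
  refine (ENNReal.toReal_mono ENNReal.ofReal_ne_top hcheb).trans ?_
  rw [ENNReal.toReal_ofReal (div_nonneg (variance_nonneg _ _) (sq_nonneg c))]
  gcongr

/-- A quantitative weak Glivenko–Cantelli theorem: Chebyshev's inequality at the points `k / K`
and monotonicity between them. -/
theorem exists_uniform_event (hp : ∀ i, Measurable (p i))
    (hU : ∀ i ∈ I, μ.map (p i) = volume.restrict (Icc (0 : ℝ) 1))
    (hI : iIndepFun (fun i : I => p i) μ) {K n : ℕ} (hK : 1 ≤ K) (hn : 1 ≤ n) :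
    ∃ E : Set Ω, MeasurableSet E ∧ μ.real Eᶜ ≤ (K + 1) * K ^ 2 / n ∧
      ∀ ω ∈ E, ∀ s ∈ Icc (0 : ℝ) 1,
        |(countLE I (fun i => p i ω) n s : ℝ) - numTrue I n * s| ≤ 2 * n / K := by
  have hK0 : (0 : ℝ) < K := by exact_mod_cast hK
  have hn0 : (0 : ℝ) < n := by exact_mod_cast hn
  set B : ℕ → Set Ω := fun k => {ω | (n : ℝ) / K ≤
    |(countLE I (fun i => p i ω) n ((k : ℝ) / K) : ℝ) - numTrue I n * ((k : ℝ) / K)|} with hB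
  have hBm : ∀ k, MeasurableSet (B k) := fun k => measurableSet_le measurable_const
    (((measurable_from_top.comp (measurable_countLE hp I n _)).sub measurable_const).abs)
  refine ⟨(⋃ k ∈ Finset.range (K + 1), B k)ᶜ, ?_, ?_, ?_⟩
  · exact ((Finset.range (K + 1)).measurableSet_biUnion fun k _ => hBm k).compl
  · rw [compl_compl]
    calc μ.real (⋃ k ∈ Finset.range (K + 1), B k)
        ≤ ∑ k ∈ Finset.range (K + 1), μ.real (B k) := measureReal_biUnion_finset_le _ _
      _ ≤ ∑ k ∈ Finset.range (K + 1), (n : ℝ) / ((n : ℝ) / K) ^ 2 := by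
          refine Finset.sum_le_sum fun k hk => ?_
          exact countLE_concentration hp hU hI
            (natCast_div_mem (Nat.lt_succ_iff.1 (Finset.mem_range.1 hk))) n (by positivity)
      _ = (K + 1) * K ^ 2 / n := by
          rw [Finset.sum_const, Finset.card_range, nsmul_eq_mul]
          push_cast
          field_simp
  · intro ω hω s hs
    have hgrid : ∀ k : ℕ, k ≤ K →
        |(countLE I (fun i => p i ω) n ((k : ℝ) / K) : ℝ) - numTrue I n * ((k : ℝ) / K)|
          < n / K := by
      intro k hk
      by_contra hcon
      push Not at hcon
      exact hω (mem_iUnion₂.2 ⟨k, Finset.mem_range.2 (by omega), hcon⟩)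
    have hn0' : (numTrue I n : ℝ) ≤ n := by exact_mod_cast numTrue_le I n
    have hnn : (0 : ℝ) ≤ numTrue I n := Nat.cast_nonneg _
    have hstep : (numTrue I n : ℝ) * (1 / K) ≤ n / K := by
      rw [mul_one_div]
      gcongr
    -- `s` lies between two consecutive grid points
    set k := ⌊s * K⌋₊ with hk
    have hk1 : (k : ℝ) ≤ s * K := Nat.floor_le (mul_nonneg hs.1 hK0.le)
    have hk2 : s * K < k + 1 := Nat.lt_floor_add_one _
    have hkK : k ≤ K := by
      have : (k : ℝ) ≤ K := hk1.trans (mul_le_of_le_one_left hK0.le hs.2)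
      exact_mod_cast this
    have hks : (k : ℝ) / K ≤ s := (div_le_iff₀ hK0).2 hk1
    have hsk : s ≤ k / K + 1 / K := by
      rw [← add_div]
      exact (le_div_iff₀ hK0).2 hk2.le
    have h2 : (2 : ℝ) * n / K = n / K + n / K := by ring
    have hlow : (countLE I (fun i => p i ω) n ((k : ℝ) / K) : ℝ) ≤
        countLE I (fun i => p i ω) n s := by exact_mod_cast countLE_mono _ _ _ hks
    have hg := abs_lt.1 (hgrid k hkK)
    have hm1 := mul_le_mul_of_nonneg_left hsk hnn
    rw [abs_le, h2]
    refine ⟨by linarith, ?_⟩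
    rcases hkK.lt_or_eq with hlt | heq
    · have hg' := abs_lt.1 (hgrid (k + 1) hlt)
      have hup : (countLE I (fun i => p i ω) n s : ℝ) ≤
          countLE I (fun i => p i ω) n (((k + 1 : ℕ) : ℝ) / K) := by
        refine Nat.cast_le.2 (countLE_mono _ _ _ ?_)
        push_cast
        rwa [add_div]
      have hm2 := mul_le_mul_of_nonneg_left hks hnn
      push_cast at hg' hup
      rw [add_div] at hg' hup
      linarith
    · have hs1 : s = k / K := by
        rw [heq, div_self hK0.ne'] at hks ⊢
        exact le_antisymm hs.2 hks
      rw [← hs1] at hg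
      linarith [div_pos hn0 hK0]

/-- The exceptional probability of the uniform law of large numbers is `O(1 / n)`, with a constant
that depends neither on the measure nor on the index set. -/
theorem exists_uniform_const {ε : ℝ} (hε : 0 < ε) : ∃ C : ℝ, 0 ≤ C ∧
    ∀ {Ω : Type*} [MeasurableSpace Ω] (μ : Measure Ω) [IsProbabilityMeasure μ] (p : ℕ → Ω → ℝ)
      (I : Set ℕ), (∀ i, Measurable (p i)) →
      (∀ i ∈ I, μ.map (p i) = volume.restrict (Icc (0 : ℝ) 1)) →
      iIndepFun (fun i : I => p i) μ → ∀ n : ℕ, 1 ≤ n →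
      ∃ E : Set Ω, MeasurableSet E ∧ μ.real Eᶜ ≤ C / n ∧
        ∀ ω ∈ E, ∀ s ∈ Icc (0 : ℝ) 1,
          |(countLE I (fun i => p i ω) n s : ℝ) - numTrue I n * s| ≤ ε * n := by
  obtain ⟨K, hK⟩ := exists_nat_gt (2 / ε)
  have hK0 : (0 : ℝ) < K := (by positivity : 0 < 2 / ε).trans hK
  refine ⟨(K + 1) * K ^ 2, by positivity, ?_⟩
  intro Ω _ μ _ p I hp hU hI n hn
  obtain ⟨E, hE, hμ, h⟩ := exists_uniform_event hp hU hI (K := K) (by exact_mod_cast hK0) hn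
  refine ⟨E, hE, hμ, fun ω hω s hs => (h ω hω s hs).trans ?_⟩
  rw [mul_comm 2, mul_div_assoc, mul_comm ε]
  have : (2 : ℝ) / K ≤ ε := by
    rw [div_lt_iff₀ hε] at hK
    rw [div_le_iff₀ hK0]
    linarith
  gcongr

end LLN

/-! ### Dirac-uniform configurations of a given asymptotic density -/

/-- Every `ζ ∈ [0,1]` is the density of a set of natural numbers, a Beatty sequence. -/
theorem exists_tendsto_propTrue {ζ : ℝ} (hζ : ζ ∈ Icc (0 : ℝ) 1) :
    ∃ I : Set ℕ, Tendsto (propTrue I) atTop (𝓝 ζ) := by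
  classical
  set I : Set ℕ := {i | ⌊ζ * ((i + 1 : ℕ) : ℝ)⌋₊ ≠ ⌊ζ * (i : ℝ)⌋₊} with hI
  have hcount : ∀ n : ℕ, numTrue I n = ⌊ζ * (n : ℝ)⌋₊ := by
    intro n
    induction n with
    | zero => simp [numTrue]
    | succ n ih =>
      have hmono : ⌊ζ * (n : ℝ)⌋₊ ≤ ⌊ζ * ((n + 1 : ℕ) : ℝ)⌋₊ :=
        Nat.floor_mono (mul_le_mul_of_nonneg_left (by push_cast; linarith) hζ.1)
      have hstep : ⌊ζ * ((n + 1 : ℕ) : ℝ)⌋₊ ≤ ⌊ζ * (n : ℝ)⌋₊ + 1 := by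
        rw [← Nat.floor_add_one (mul_nonneg hζ.1 (Nat.cast_nonneg n))]
        refine Nat.floor_mono ?_
        push_cast
        linarith [hζ.2]
      have hs : numTrue I (n + 1) = numTrue I n + if n ∈ I then 1 else 0 := by
        unfold numTrue
        rw [Finset.range_add_one, Finset.filter_insert]
        split_ifs
        · rw [Finset.card_insert_of_notMem (by simp)]
        · rfl
      rw [hs, ih]
      by_cases hn : n ∈ I
      · rw [if_pos hn]
        have : ⌊ζ * ((n + 1 : ℕ) : ℝ)⌋₊ ≠ ⌊ζ * (n : ℝ)⌋₊ := hn
        omega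
      · rw [if_neg hn]
        have : ⌊ζ * ((n + 1 : ℕ) : ℝ)⌋₊ = ⌊ζ * (n : ℝ)⌋₊ := not_not.1 hn
        omega
  refine ⟨I, ?_⟩
  have h := (tendsto_nat_floor_mul_div_atTop (R := ℝ) hζ.1).comp tendsto_natCast_atTop_atTop
  refine h.congr fun n => ?_
  simp only [Function.comp, propTrue, hcount]

theorem numTrue_eq_mul_propTrue (I : Set ℕ) {n : ℕ} (hn : 1 ≤ n) :
    (numTrue I n : ℝ) = n * propTrue I n := by
  have : (0 : ℝ) < n := by exact_mod_cast hn
  unfold propTrue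
  field_simp

theorem propTrue_mem (I : Set ℕ) (n : ℕ) : propTrue I n ∈ Icc (0 : ℝ) 1 :=
  natCast_div_mem (numTrue_le I n)

namespace Model

variable {Θ Ω : Type*} [MeasurableSpace Ω] (M : Model Θ Ω)

theorem le_fdp {I : Set ℕ} {ρ : ℝ → ℝ} {n l : ℕ} {ω : Ω} {c : ℝ} (hc0 : 0 ≤ c)
    (hV : 0 < (M.numFalseRej I ρ n l ω : ℝ))
    (h : c * numTrue Iᶜ n ≤ (1 - c) * M.numFalseRej I ρ n l ω) : c ≤ M.fdp I ρ n l ω := by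
  have hV1 : (1 : ℝ) ≤ M.numFalseRej I ρ n l ω := by
    exact_mod_cast Nat.succ_le_of_lt (by exact_mod_cast hV)
  have hW : (M.numFalseRej Iᶜ ρ n l ω : ℝ) ≤ numTrue Iᶜ n := by
    exact_mod_cast M.numFalseRej_le_numTrue Iᶜ ρ n l ω
  have hR : (M.numRej ρ n l ω : ℝ) = M.numFalseRej I ρ n l ω + M.numFalseRej Iᶜ ρ n l ω := by
    exact_mod_cast M.numRej_eq_add I ρ n l ω
  have hW0 : (0 : ℝ) ≤ M.numFalseRej Iᶜ ρ n l ω := Nat.cast_nonneg _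
  unfold fdp
  rw [max_eq_left (by linarith), le_div_iff₀ (by linarith), hR]
  have := mul_le_mul_of_nonneg_left hW hc0
  linarith

theorem mul_le_expFDP {μ : Measure Ω} [IsProbabilityMeasure μ] {I : Set ℕ} {ρ : ℝ → ℝ} {n l : ℕ}
    (hl1 : 1 ≤ l) (hln : l ≤ n) {E : Set Ω} (hE : MeasurableSet E) {c : ℝ}
    (h : ∀ᵐ ω ∂μ, ω ∈ E → c ≤ M.fdp I ρ n l ω) :
    c * (1 - μ.real Eᶜ) ≤ M.expFDP μ I ρ n l := by
  have h1 : c * (1 - μ.real Eᶜ) = ∫ ω, E.indicator (fun _ => c) ω ∂μ := by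
    rw [integral_indicator_const c hE, probReal_compl_eq_one_sub hE, smul_eq_mul]
    ring
  rw [h1]
  refine integral_mono_ae ((integrable_const c).indicator hE) (M.integrable_fdp μ I ρ hl1 hln) ?_
  filter_upwards [h] with ω hω
  by_cases hmem : ω ∈ E
  · rw [indicator_of_mem hmem]
    exact hω hmem
  · rw [indicator_of_notMem hmem]
    exact M.fdp_nonneg I ρ n l ω

/-- Under a Dirac-uniform configuration of density `ζ` the empirical distribution function of all
p-values is close to `s ↦ 1 - ζ + ζ s`. If this forces the index of the procedure to be at least
`j n`, with critical value tending to `t`, then asymptotically at least the proportion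
`ζ t / (1 - ζ + ζ t)` of the rejections is false. -/
theorem eventually_le_FDRDU {I : Set ℕ} {ζ : ℝ} (hζ : Tendsto (propTrue I) atTop (𝓝 ζ))
    {ρ : ℝ → ℝ} (hρ : IsCriticalValueFunction ρ) {l j : ℕ → ℕ} {t : ℝ}
    (ht : Tendsto (fun n => critValue ρ n (j n)) atTop (𝓝 t))
    (hl : ∀ᶠ n in atTop, 1 ≤ l n ∧ l n ≤ n) {δ : ℝ} (hδ : 0 < δ)
    (H : ∀ᶠ n : ℕ in atTop, 1 ≤ j n ∧ j n ≤ n ∧ ∀ x : ℕ → ℝ, (∀ i, x i ∈ Icc (0 : ℝ) 1) →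
      (∀ s ∈ Icc (0 : ℝ) 1, n * (1 - ζ + ζ * s - δ) ≤ (countLE univ x n s : ℝ)) →
      j n ≤ sudIndex ρ n (l n) x)
    {c : ℝ} (hc : c ∈ Ioo (0 : ℝ) 1) (hcζ : c * (1 - ζ) < (1 - c) * (ζ * t)) {c' : ℝ}
    (hc' : c' < c) : ∀ᶠ n in atTop, c' ≤ M.FDRDU I ρ n (l n) := by
  have : IsProbabilityMeasure (M.DU I) := M.DU_isProb I
  obtain ⟨ε, hε0, hε1, hε2⟩ : ∃ ε : ℝ, 0 < ε ∧ ε ≤ δ / 2 ∧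
      ε < (1 - c) * (ζ * t) - c * (1 - ζ) := by
    refine ⟨min (δ / 2) (((1 - c) * (ζ * t) - c * (1 - ζ)) / 2), ?_, min_le_left _ _, ?_⟩
    · exact lt_min (by linarith) (by linarith)
    · exact (min_le_right _ _).trans_lt (by linarith)
  obtain ⟨C, hC0, hC⟩ := exists_uniform_const hε0
  have e1 : ∀ᶠ n in atTop, |propTrue I n - ζ| < δ / 2 := by
    have h := (Metric.tendsto_nhds.1 hζ) (δ / 2) (by linarith)
    simpa [Real.dist_eq] using h
  have e2 : ∀ᶠ n in atTop, c * (1 - propTrue I n) <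
      (1 - c) * (propTrue I n * critValue ρ n (j n) - ε) := by
    refine (((tendsto_const_nhds.sub hζ).const_mul c)).eventually_lt
      (((hζ.mul ht).sub_const ε).const_mul (1 - c)) ?_
    nlinarith [hc.1, mul_pos hc.1 hε0]
  have e3 : ∀ᶠ n : ℕ in atTop, c' < c * (1 - C / n) := by
    have h : Tendsto (fun n : ℕ => c * (1 - C / n)) atTop (𝓝 (c * (1 - 0))) :=
      (tendsto_const_nhds.sub (tendsto_const_div_atTop_nhds_zero_nat C)).const_mul c
    exact h.eventually_const_lt (by linarith)
  filter_upwards [e1, e2, e3, hl, H, eventually_ge_atTop 1] with n h1 h2 h3 ⟨hl1, hln⟩ ⟨hj1, hjn, hH⟩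
    hn
  obtain ⟨E, hEm, hE, hEs⟩ := hC (M.DU I) M.p I M.p_measurable (M.DU_uniform I) (M.DU_indep I) n hn
  have hn0 : (0 : ℝ) < n := by exact_mod_cast hn
  have hz : ∀ᵐ ω ∂(M.DU I), ∀ i ∈ Iᶜ, M.p i ω = 0 := by
    refine ae_all_iff.2 fun i => ?_
    by_cases hi : i ∈ I
    · exact ae_of_all _ fun ω h => absurd hi h
    · filter_upwards [M.DU_dirac I i hi] with ω hω _ using hω
  refine (h3.le.trans ?_).trans (M.mul_le_expFDP hl1 hln hEm (c := c) ?_)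
  · exact mul_le_mul_of_nonneg_left (by linarith) hc.1.le
  filter_upwards [hz] with ω hω hωE
  set x : ℕ → ℝ := fun i => M.p i ω with hx
  have hn1 : (numTrue Iᶜ n : ℝ) = n - numTrue I n := by
    rw [eq_sub_iff_add_eq']
    exact_mod_cast numTrue_add_compl I n
  have hprop := numTrue_eq_mul_propTrue I hn
  have hζn := propTrue_mem I n
  have hm : j n ≤ sudIndex ρ n (l n) x := by
    refine hH x (fun i => M.p_mem i ω) fun s hs => ?_
    have hcompl : countLE Iᶜ x n s = numTrue Iᶜ n :=
      countLE_eq_numTrue fun i hi _ => by simp only [hx, hω i hi, hs.1]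
    rw [countLE_univ I, hcompl]
    push_cast
    rw [hn1]
    have hb := (abs_le.1 (hEs ω hωE s hs)).1
    have hb' : -(δ / 2) ≤ (ζ - propTrue I n) * (1 - s) := by
      have := (abs_lt.1 h1)
      nlinarith [hs.1, hs.2]
    rw [hprop] at hb ⊢
    have hb2 := mul_le_mul_of_nonneg_left hb' hn0.le
    have hb3 := mul_le_mul_of_nonneg_left hε1 hn0.le
    linarith
  have hm1 := hj1.trans hm
  have hmn : sudIndex ρ n (l n) x ≤ n := sudIndex_le hln
  have hV : n * (propTrue I n * critValue ρ n (j n) - ε) ≤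
      (M.numFalseRej I ρ n (l n) ω : ℝ) := by
    rw [M.numFalseRej_eq, if_pos hm1]
    have hb := (abs_le.1 (hEs ω hωE _ (critValue_mem hρ hjn))).1
    have hmono : (countLE I x n (critValue ρ n (j n)) : ℝ) ≤
        countLE I x n (critValue ρ n (sudIndex ρ n (l n) x)) :=
      Nat.cast_le.2 (countLE_mono _ _ _ (critValue_mono hρ hm hmn))
    rw [hprop] at hb
    linarith
  have hV' := mul_le_mul_of_nonneg_left hV (sub_nonneg.2 hc.2.le)
  have h2' := mul_lt_mul_of_pos_left h2 hn0
  have h0 : 0 ≤ n * (c * (1 - propTrue I n)) :=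
    mul_nonneg hn0.le (mul_nonneg hc.1.le (by linarith [hζn.2]))
  refine M.le_fdp hc.1.le ?_ ?_
  · refine pos_of_mul_pos_right (a := 1 - c) ?_ (by linarith [hc.2])
    linarith
  · rw [hn1, hprop]
    linarith

theorem limsup_FDRDU_le {α lam : ℝ} {ρ : ℝ → ℝ} (hρ : ρ ∈ M.curveClass α lam) {I : Set ℕ} {ζ : ℝ}
    (hζ : ζ ∈ Icc (0 : ℝ) 1) (hI : Tendsto (propTrue I) atTop (𝓝 ζ)) {c : ℝ}
    (hc : ∀ᶠ n in atTop, c ≤ M.FDRDU I ρ n (sudOrder ρ lam n)) : c ≤ α := by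
  obtain ⟨h1, h2⟩ := hρ.2 I ζ hζ hI
  refine le_trans ?_ (h1.trans h2)
  refine le_limsup_of_frequently_le hc.frequently ?_
  refine isBoundedUnder_of ⟨1, fun n => ?_⟩
  have : IsProbabilityMeasure (M.DU I) := M.DU_isProb I
  exact M.expFDP_le_one _ _ _ _ _

end Model

/-! ### Critical value functions and rejection curves -/

theorem IsCriticalValueFunction.exists_least {ρ : ℝ → ℝ} (hρ : IsCriticalValueFunction ρ)
    {t u : ℝ} (ht : 0 ≤ t) (hu : u ∈ Icc (0 : ℝ) 1) (htu : t ≤ ρ u) :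
    ∃ v ∈ Icc (0 : ℝ) u, ρ v = t ∧ ∀ w ∈ Icc (0 : ℝ) 1, t ≤ ρ w → v ≤ w := by
  have hS : IsCompact (Icc (0 : ℝ) 1 ∩ ρ ⁻¹' Ici t) :=
    isCompact_Icc.of_isClosed_subset
      (hρ.continuousOn.preimage_isClosed_of_isClosed isClosed_Icc isClosed_Ici) inter_subset_left
  obtain ⟨v, ⟨hv1, hv2⟩, hv3⟩ := hS.exists_isLeast ⟨u, hu, htu⟩
  have hmin : ∀ w ∈ Icc (0 : ℝ) 1, t ≤ ρ w → v ≤ w := fun w hw1 hw2 => hv3 ⟨hw1, hw2⟩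
  refine ⟨v, ⟨hv1.1, hmin u hu htu⟩, ?_, hmin⟩
  have hcont : ContinuousOn ρ (Icc 0 v) :=
    hρ.continuousOn.mono (Icc_subset_Icc_right hv1.2)
  obtain ⟨w, hw1, hw2⟩ := intermediate_value_Icc hv1.1 hcont
    (show t ∈ Icc (ρ 0) (ρ v) from ⟨by rwa [hρ.map_zero], hv2⟩)
  have hwv : w = v := le_antisymm hw1.2 (hmin w ⟨hw1.1, hw1.2.trans hv1.2⟩ hw2.ge)
  rw [← hwv, hw2]

theorem rejectionCurve_eq_coe {ρ : ℝ → ℝ} {t v : ℝ} (hv : v ∈ Icc (0 : ℝ) 1) (hvt : ρ v = t)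
    (hmin : ∀ w ∈ Icc (0 : ℝ) 1, t ≤ ρ w → v ≤ w) : rejectionCurve ρ t = (v : EReal) := by
  unfold rejectionCurve
  refine le_antisymm (iInf₂_le v ⟨hv, hvt⟩) (le_iInf₂ fun w hw => ?_)
  exact_mod_cast hmin w hw.1 hw.2.ge

theorem map_aorc_of_rejectionCurve_eq {ρ : ℝ → ℝ} (hρ : IsCriticalValueFunction ρ) {α t : ℝ}
    (ht : 0 ≤ t) (h : rejectionCurve ρ t = (aorc α t : EReal)) :
    aorc α t ∈ Icc (0 : ℝ) 1 ∧ ρ (aorc α t) = t := by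
  have hex : ∃ u ∈ Icc (0 : ℝ) 1, ρ u = t := by
    by_contra! hcon
    have : rejectionCurve ρ t = ⊤ := by
      unfold rejectionCurve
      exact iInf₂_eq_top.2 fun u hu => absurd hu.2 (hcon u hu.1)
    rw [this] at h
    exact EReal.coe_ne_top _ h.symm
  obtain ⟨u, hu, hut⟩ := hex
  obtain ⟨v, hv, hvt, hmin⟩ := hρ.exists_least ht hu hut.ge
  have hv01 : v ∈ Icc (0 : ℝ) 1 := ⟨hv.1, hv.2.trans hu.2⟩
  rw [rejectionCurve_eq_coe hv01 hvt hmin, EReal.coe_eq_coe_iff] at h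
  rw [← h]
  exact ⟨hv01, hvt⟩

/-- To bound a rejection curve from below at `t > 0` it suffices to consider the least solution
of `ρ v = t`. -/
theorem aorc_le_rejectionCurve_of {ρ : ℝ → ℝ} (hρ : IsCriticalValueFunction ρ) {α t : ℝ}
    (ht : 0 ≤ t)
    (h : ∀ v ∈ Ioc (0 : ℝ) 1, ρ v = t → 0 < t → (∀ w ∈ Icc (0 : ℝ) 1, t ≤ ρ w → v ≤ w) →
      aorc α t ≤ v) : (aorc α t : EReal) ≤ rejectionCurve ρ t := by
  refine le_iInf₂ fun u hu => ?_
  rcases ht.eq_or_lt with rfl | htp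
  · simpa [aorc] using hu.1.1
  obtain ⟨v, hv1, hv2, hv3⟩ := hρ.exists_least ht hu.1 hu.2.ge
  have hv0 : 0 < v := by
    refine hv1.1.lt_of_ne ?_
    rintro rfl
    rw [hρ.map_zero] at hv2
    exact htp.ne hv2
  exact_mod_cast (h v ⟨hv0, hv1.2.trans hu.1.2⟩ hv2 htp hv3).trans hv1.2

/-- The density `ζ` for which the line `s ↦ 1 - ζ + ζ s` meets `aorc α` at `t`. -/
noncomputable def critDensity (α t : ℝ) : ℝ := α / (t * (1 - α) + α)

section Aorc

variable {α : ℝ} (hα : α ∈ Ioo (0 : ℝ) 1)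
include hα

theorem aorc_denom_pos {t : ℝ} (ht : 0 ≤ t) : 0 < t * (1 - α) + α := by
  have := mul_nonneg ht (sub_nonneg.2 hα.2.le)
  linarith [hα.1]

theorem critDensity_lt_one {t : ℝ} (ht : 0 < t) : critDensity α t < 1 := by
  unfold critDensity
  rw [div_lt_one (aorc_denom_pos hα ht.le)]
  have := mul_pos ht (sub_pos.2 hα.2)
  linarith

theorem le_critDensity {t : ℝ} (ht : t ∈ Icc (0 : ℝ) 1) : α ≤ critDensity α t := by
  unfold critDensity
  rw [le_div_iff₀ (aorc_denom_pos hα ht.1)]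
  nlinarith [ht.2, hα.1, hα.2, mul_le_mul_of_nonneg_right ht.2 (sub_nonneg.2 hα.2.le)]

theorem aorc_eq_line {t : ℝ} (ht : 0 ≤ t) :
    aorc α t = 1 - critDensity α t + critDensity α t * t := by
  have := (aorc_denom_pos hα ht).ne'
  unfold aorc critDensity
  field_simp
  ring

theorem critDensity_strictAnti {s t : ℝ} (hs : 0 ≤ s) (hst : s < t) :
    critDensity α t < critDensity α s := by
  have h1 := aorc_denom_pos hα hs
  have := mul_lt_mul_of_pos_right hst (sub_pos.2 hα.2)
  exact div_lt_div_of_pos_left hα.1 h1 (by linarith)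

/-- By concavity, `aorc α` lies strictly below its chord through `(t, aorc α t)` and `(1, 1)` to
the left of `t`. -/
theorem aorc_lt_line {s t : ℝ} (hs : 0 ≤ s) (hst : s < t) (hs1 : s < 1) :
    aorc α s < 1 - critDensity α t + critDensity α t * s := by
  rw [aorc_eq_line hα hs]
  nlinarith [critDensity_strictAnti hα hs hst]

theorem aorc_le_one {t : ℝ} (ht : t ∈ Icc (0 : ℝ) 1) : aorc α t ≤ 1 := by
  unfold aorc
  rw [div_le_one (aorc_denom_pos hα ht.1)]
  nlinarith [ht.2, hα.1]

end Aorc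

/-! ### Lower bounds for curves in the class -/

namespace Model

variable {Θ Ω : Type*} [MeasurableSpace Ω] (M : Model Θ Ω)

/-- If `ρ` exceeds the critical value function of `aorc α` at `u`, in the sense that
`u < aorc α (ρ u)`, then for a density slightly above `critDensity α (ρ u)` the asymptotic false
discovery rate exceeds `α`, provided the procedure reaches `u`; it does so when the limiting
empirical distribution function stays above the rejection curve from the order of the procedure
up to `u`. -/
theorem false_of_lt_line {α lam : ℝ} (hα : α ∈ Ioo (0 : ℝ) 1) {ρ : ℝ → ℝ}
    (hρ : ρ ∈ M.curveClass α lam) {a u : ℝ} (ha : 0 ≤ a) (hau : a < u) (hu : u ≤ 1)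
    (hline : ∀ v ∈ Icc a u, v < 1 - critDensity α (ρ u) + critDensity α (ρ u) * ρ v)
    (hl : ∀ᶠ n : ℕ in atTop, a * n ≤ sudOrder ρ lam n) : False := by
  have hcv := hρ.1
  have hsub : Icc a u ⊆ Icc (0 : ℝ) 1 := Icc_subset_Icc ha hu
  have hu0 : 0 < u := ha.trans_lt hau
  have hu01 : u ∈ Icc (0 : ℝ) 1 := ⟨hu0.le, hu⟩
  have htp : 0 < ρ u := hcv.pos u ⟨hu0, hu⟩
  set t := ρ u with ht
  set z := critDensity α t with hz
  have hz0 : 0 < z := div_pos hα.1 (aorc_denom_pos hα htp.le)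
  have hz1 : z < 1 := critDensity_lt_one hα htp
  obtain ⟨δ, hδ0, hδ⟩ : ∃ δ : ℝ, 0 < δ ∧ ∀ v ∈ Icc a u, v + δ ≤ 1 - z + z * ρ v := by
    have hcont : ContinuousOn (fun v => 1 - z + z * ρ v - v) (Icc a u) :=
      (continuousOn_const.add (continuousOn_const.mul (hcv.continuousOn.mono hsub))).sub
        continuousOn_id
    obtain ⟨v₀, hv₀, hmin⟩ := isCompact_Icc.exists_isMinOn (nonempty_Icc.2 hau.le) hcont
    refine ⟨1 - z + z * ρ v₀ - v₀, by linarith [hline v₀ hv₀], fun v hv => ?_⟩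
    have := isMinOn_iff.1 hmin v hv
    linarith
  obtain ⟨ζ, hζz, hζ1, hζδ⟩ : ∃ ζ : ℝ, z < ζ ∧ ζ < 1 ∧ ζ - z ≤ δ / 2 := by
    refine ⟨min (z + δ / 2) ((z + 1) / 2), lt_min (by linarith) (by linarith), ?_, ?_⟩
    · exact (min_le_right _ _).trans_lt (by linarith)
    · linarith [min_le_left (z + δ / 2) ((z + 1) / 2)]
  have hζ01 : ζ ∈ Icc (0 : ℝ) 1 := ⟨by linarith, hζ1.le⟩
  have hζline : ∀ v ∈ Icc a u, v ≤ 1 - ζ + ζ * ρ v - δ / 2 := by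
    intro v hv
    have h1 := (hcv.mapsTo (hsub hv))
    nlinarith [hδ v hv, mul_nonneg (sub_nonneg.2 hζz.le) h1.1]
  obtain ⟨I, hI⟩ := exists_tendsto_propTrue hζ01
  -- the asymptotic false discovery proportion for the density `ζ` exceeds `α`
  have hgap : 0 < (1 - α) * (ζ * t) - α * (1 - ζ) := by
    have hD := aorc_denom_pos hα htp.le
    have h1 : z * (t * (1 - α) + α) = α := div_mul_cancel₀ _ hD.ne'
    nlinarith [mul_lt_mul_of_pos_right hζz hD]
  set γ := (1 - α) * (ζ * t) - α * (1 - ζ) with hγ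
  have ht1 : t ≤ 1 := (hcv.mapsTo hu01).2
  have hζt : ζ * t ≤ 1 := by nlinarith [hζ01.1]
  have hζt0 : 0 ≤ ζ * t := mul_nonneg hζ01.1 htp.le
  have hγ1 : γ ≤ 1 - α := by
    have h1 := mul_le_mul_of_nonneg_left hζt (sub_nonneg.2 hα.2.le)
    have h2 := mul_nonneg hα.1.le (sub_nonneg.2 hζ1.le)
    linarith
  have hc : α + γ / 2 ∈ Ioo (0 : ℝ) 1 := ⟨by linarith [hα.1], by linarith [hα.2]⟩
  have hcζ : (α + γ / 2) * (1 - ζ) < (1 - (α + γ / 2)) * (ζ * t) := by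
    have h2 : 1 - ζ + ζ * t ≤ 1 := by nlinarith
    nlinarith [mul_le_mul_of_nonneg_left h2 hgap.le]
  have hj : Tendsto (fun n : ℕ => critValue ρ n ⌊u * (n : ℝ)⌋₊) atTop (𝓝 t) := by
    have h1 : Tendsto (fun n : ℕ => (⌊u * (n : ℝ)⌋₊ : ℝ) / n) atTop (𝓝[Icc 0 1] u) := by
      refine tendsto_nhdsWithin_iff.2 ⟨(tendsto_nat_floor_mul_div_atTop (R := ℝ) hu0.le).comp
        tendsto_natCast_atTop_atTop, Eventually.of_forall fun n => natCast_div_mem ?_⟩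
      exact Nat.floor_le_of_le (mul_le_of_le_one_left (Nat.cast_nonneg n) hu)
    exact (hcv.continuousOn u hu01).tendsto.comp h1
  have hord : ∀ᶠ n in atTop, 1 ≤ sudOrder ρ lam n ∧ sudOrder ρ lam n ≤ n := by
    filter_upwards [eventually_ge_atTop 1] with n hn using ⟨one_le_sudOrder hn, sudOrder_le⟩
  have H := M.eventually_le_FDRDU hI hcv hj hord (half_pos hδ0) ?_ hc hcζ
    (show α + γ / 4 < α + γ / 2 by linarith)
  · linarith [M.limsup_FDRDU_le hρ hζ01 hI H]
  have hlarge : ∀ᶠ n : ℕ in atTop, 2 ≤ (u - a) * n :=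
    (tendsto_natCast_atTop_atTop.const_mul_atTop (sub_pos.2 hau)).eventually_ge_atTop 2
  filter_upwards [hl, hlarge, eventually_ge_atTop 1] with n hln hn2 hn1
  have hn0 : (0 : ℝ) < n := by exact_mod_cast hn1
  have hun : 0 ≤ u * n := by positivity
  have hfl := Nat.floor_le hun
  have hfl' := Nat.lt_floor_add_one (u * (n : ℝ))
  have han : 0 ≤ a * n := by positivity
  have hjn : ⌊u * (n : ℝ)⌋₊ ≤ n :=
    Nat.floor_le_of_le (mul_le_of_le_one_left (Nat.cast_nonneg n) hu)
  have hj1 : 1 ≤ ⌊u * (n : ℝ)⌋₊ := Nat.le_floor (by push_cast; nlinarith)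
  refine ⟨hj1, hjn, fun x _ hx => ?_⟩
  refine le_sudIndex (a := ⌈a * (n : ℝ)⌉₊) (one_le_sudOrder hn1) sudOrder_le hj1 hjn
    (Nat.ceil_le.2 hln) (Nat.ceil_le.2 (by nlinarith)) fun i _ hai hij => ?_
  have hi1 : a ≤ (i : ℝ) / n := (le_div_iff₀ hn0).2 (Nat.ceil_le.1 hai)
  have hi2 : (i : ℝ) / n ≤ u := (div_le_iff₀ hn0).2 (le_trans (by exact_mod_cast hij) hfl)
  have h1 := hx _ (critValue_mem hcv (hij.trans hjn))
  have h2 := mul_le_mul_of_nonneg_left (hζline _ ⟨hi1, hi2⟩) hn0.le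
  rw [mul_div_cancel₀ _ hn0.ne'] at h2
  exact_mod_cast h2.trans h1

theorem mul_le_sudOrder {ρ : ℝ → ℝ} {lam a : ℝ} (ha : a ≤ 1)
    (hmin : ∀ w ∈ Icc (0 : ℝ) 1, lam ≤ ρ w → a ≤ w) :
    ∀ᶠ n : ℕ in atTop, a * n ≤ sudOrder ρ lam n := by
  filter_upwards [eventually_ge_atTop 1] with n hn
  have hn0 : (0 : ℝ) < n := by exact_mod_cast hn
  rcases sudOrder_mem (ρ := ρ) (lam := lam) (n := n) with h | ⟨_, h2, h3⟩
  · rw [h]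
    exact mul_le_of_le_one_left hn0.le ha
  · exact (le_div_iff₀ hn0).1 (hmin _ (natCast_div_mem h2) h3)

/-- Up to `λ` the procedure of order `λ_n` is of step-up type, so that `aorc α` is a lower
bound without further conditions. -/
theorem aorc_le_rejectionCurve_of_le {α lam : ℝ} (hα : α ∈ Ioo (0 : ℝ) 1)
    {ρ : ℝ → ℝ} (hρ : ρ ∈ M.curveClass α lam) {t : ℝ} (ht : t ∈ Icc (0 : ℝ) lam) :
    (aorc α t : EReal) ≤ rejectionCurve ρ t := by
  have hcv := hρ.1
  refine aorc_le_rejectionCurve_of hcv ht.1 fun v hv hvt htp hmin => ?_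
  by_contra! hlt
  have hsub : Icc (0 : ℝ) v ⊆ Icc 0 1 := Icc_subset_Icc_right hv.2
  have hcont : ContinuousWithinAt (fun w => 1 - critDensity α t + critDensity α t * ρ w)
      (Icc 0 v) v := continuousWithinAt_const.add (continuousWithinAt_const.mul
        ((hcv.continuousOn v ⟨hv.1.le, hv.2⟩).mono hsub))
  rw [aorc_eq_line hα htp.le] at hlt
  have hev : ∀ᶠ w in 𝓝[Icc 0 v] v, w < 1 - critDensity α t + critDensity α t * ρ w := by
    have hid : Tendsto (fun w : ℝ => w) (𝓝[Icc 0 v] v) (𝓝 v) := nhdsWithin_le_nhds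
    exact hid.eventually_lt hcont.tendsto (by rw [hvt]; exact hlt)
  rw [nhdsWithin_Icc_eq_nhdsLE hv.1] at hev
  obtain ⟨a, hav, ha⟩ := (mem_nhdsLE_iff_exists_Icc_subset).1 hev
  refine M.false_of_lt_line hα hρ (le_max_right a 0) (max_lt hav hv.1) hv.2 (fun w hw => ?_)
    (mul_le_sudOrder (max_le (hav.le.trans hv.2) zero_le_one) fun w hw hlw => ?_)
  · rw [hvt]
    exact ha ⟨(le_max_left _ _).trans hw.1, hw.2⟩
  · exact (max_lt hav hv.1).le.trans (hmin w hw (ht.2.trans hlw))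

theorem aorc_le_rejectionCurve_of_rejectionCurve_le {α lam : ℝ} (hα : α ∈ Ioo (0 : ℝ) 1)
    (hlam : lam ∈ Icc (0 : ℝ) 1) {ρ : ℝ → ℝ} (hρ : ρ ∈ M.curveClass α lam) {τ : ℝ}
    (hτ : τ ∈ Ioc lam 1) (hle : ∀ t ∈ Ioc lam τ, rejectionCurve ρ t ≤ (aorc α t : EReal)) {t : ℝ}
    (ht : t ∈ Ioc lam τ) : (aorc α t : EReal) ≤ rejectionCurve ρ t := by
  have hcv := hρ.1
  refine aorc_le_rejectionCurve_of hcv (hlam.1.trans ht.1.le) fun v hv hvt htp hmin => ?_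
  by_contra! hlt
  have hv01 : v ∈ Icc (0 : ℝ) 1 := ⟨hv.1.le, hv.2⟩
  obtain ⟨a, ha, haρ, hamin⟩ := hcv.exists_least hlam.1 hv01 (ht.1.le.trans hvt.ge)
  have hav : a < v := by
    refine ha.2.lt_of_ne ?_
    rintro rfl
    exact ht.1.ne (haρ.symm.trans hvt)
  refine M.false_of_lt_line hα hρ ha.1 hav hv.2 (fun w hw => ?_)
    (mul_le_sudOrder (ha.2.trans hv.2) hamin)
  rw [hvt]
  rcases hw.2.eq_or_lt with rfl | hwv
  · rw [hvt, ← aorc_eq_line hα htp.le]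
    exact hlt
  have hw01 : w ∈ Icc (0 : ℝ) 1 := ⟨ha.1.trans hw.1, hwv.le.trans hv.2⟩
  have hst : ρ w < t := by
    by_contra! h
    exact hwv.not_ge (hmin w hw01 h)
  have hs0 : 0 ≤ ρ w := (hcv.mapsTo hw01).1
  have hls : lam ≤ ρ w := haρ.ge.trans (hcv.monotoneOn ⟨ha.1, ha.2.trans hv.2⟩ hw01 hw.1)
  -- `r` need not be continuous, but `w` is at most `r(s')` for every `s' > ρ w`
  have hwle : ∀ s' ∈ Ioo (ρ w) t, w ≤ aorc α s' := by
    intro s' hs'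
    obtain ⟨w', hw', hw's, hw'min⟩ := hcv.exists_least (hs0.trans hs'.1.le) hv01
      (hs'.2.le.trans hvt.ge)
    have hw'01 : w' ∈ Icc (0 : ℝ) 1 := ⟨hw'.1, hw'.2.trans hv.2⟩
    have h1 := hle s' ⟨hls.trans_lt hs'.1, hs'.2.le.trans ht.2⟩
    rw [rejectionCurve_eq_coe hw'01 hw's hw'min] at h1
    refine le_trans ?_ (EReal.coe_le_coe_iff.1 h1)
    by_contra! hcon
    have := hcv.monotoneOn hw'01 hw01 hcon.le
    rw [hw's] at this
    exact this.not_gt hs'.1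
  have hwa : w ≤ aorc α (ρ w) := by
    have hcont : ContinuousAt (aorc α) (ρ w) := by
      unfold aorc
      exact continuousAt_id.div ((continuousAt_id.mul continuousAt_const).add continuousAt_const)
        (aorc_denom_pos hα hs0).ne'
    refine ge_of_tendsto (hcont.tendsto.mono_left (nhdsWithin_le_nhds (s := Ioi (ρ w)))) ?_
    filter_upwards [Ioo_mem_nhdsGT hst] with s' hs' using hwle s' hs'
  exact hwa.trans_lt (aorc_lt_line hα hs0 hst (hst.trans_le (ht.2.trans hτ.2)))

theorem aorc_le_rejectionCurve_of_subsingleton {α lam : ℝ} (hα : α ∈ Ioo (0 : ℝ) 1)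
    {ρ : ℝ → ℝ} (hρ : ρ ∈ M.curveClass α lam)
    (huniq : ∀ ζ ∈ Ioo α 1, {t : ℝ | t ∈ Ioo (0 : ℝ) 1 ∧ 1 - ζ + ζ * ρ t = t}.Subsingleton)
    {t : ℝ} (ht : t ∈ Icc (0 : ℝ) 1) : (aorc α t : EReal) ≤ rejectionCurve ρ t := by
  have hcv := hρ.1
  refine aorc_le_rejectionCurve_of hcv ht.1 fun v hv hvt htp _ => ?_
  by_contra! hlt
  rw [aorc_eq_line hα htp.le] at hlt
  have hz1 := critDensity_lt_one hα htp
  have hzα := le_critDensity hα ht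
  refine M.false_of_lt_line hα hρ le_rfl hv.1 hv.2 (fun w hw => ?_)
    (Eventually.of_forall fun n => by simp)
  rw [hvt]
  set z := critDensity α t
  by_contra! hcon
  have hw01 : w ∈ Icc (0 : ℝ) 1 := ⟨hw.1, hw.2.trans hv.2⟩
  have hwv : w < v := by
    refine hw.2.lt_of_ne ?_
    rintro rfl
    rw [hvt] at hcon
    exact hcon.not_gt hlt
  have hρw : ρ w < 1 := by
    by_contra! h
    nlinarith [hv.2, hα.1]
  have hw0 : 0 < w := by
    refine hw.1.lt_of_ne ?_
    rintro rfl
    rw [hcv.map_zero] at hcon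
    linarith
  -- for a slightly larger density the equation has a solution on either side of `w`
  obtain ⟨ζ, hζz, hζ1, hζv⟩ : ∃ ζ : ℝ, z < ζ ∧ ζ < 1 ∧ v < 1 - ζ + ζ * t := by
    refine ⟨min (z + (1 - z + z * t - v) / 2) ((z + 1) / 2), lt_min (by linarith) (by linarith),
      (min_le_right _ _).trans_lt (by linarith), ?_⟩
    have h1 := min_le_left (z + (1 - z + z * t - v) / 2) ((z + 1) / 2)
    set ζ := min (z + (1 - z + z * t - v) / 2) ((z + 1) / 2)
    have h2 : z < ζ := lt_min (by linarith) (by linarith)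
    nlinarith [mul_nonneg (sub_nonneg.2 h2.le) ht.1]
  set ψ : ℝ → ℝ := fun s => 1 - ζ + ζ * ρ s - s with hψ
  have hψc : ContinuousOn ψ (Icc 0 1) :=
    (continuousOn_const.add (continuousOn_const.mul hcv.continuousOn)).sub continuousOn_id
  have hψ0 : 0 < ψ 0 := by simp only [hψ, hcv.map_zero]; linarith
  have hψw : ψ w < 0 := by
    simp only [hψ]
    nlinarith [mul_pos (sub_pos.2 hζz) (sub_pos.2 hρw)]
  have hψv : 0 < ψ v := by simp only [hψ, hvt]; linarith
  obtain ⟨s₁, hs₁, hs₁0⟩ := intermediate_value_Icc' hw0.le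
    (hψc.mono (Icc_subset_Icc_right hw01.2)) (show (0 : ℝ) ∈ Icc (ψ w) (ψ 0) from ⟨hψw.le, hψ0.le⟩)
  obtain ⟨s₂, hs₂, hs₂0⟩ := intermediate_value_Icc hwv.le
    (hψc.mono (Icc_subset_Icc hw01.1 hv.2)) (show (0 : ℝ) ∈ Icc (ψ w) (ψ v) from ⟨hψw.le, hψv.le⟩)
  have hs₁pos : 0 < s₁ := by
    refine hs₁.1.lt_of_ne ?_
    rintro rfl
    exact hψ0.ne' hs₁0
  have hs₁w : s₁ < w := by
    refine hs₁.2.lt_of_ne ?_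
    rintro rfl
    exact hψw.ne hs₁0
  have hs₂v : s₂ < v := by
    refine hs₂.2.lt_of_ne ?_
    rintro rfl
    exact hψv.ne' hs₂0
  have h := huniq ζ ⟨hzα.trans_lt hζz, hζ1⟩
    (show s₁ ∈ _ from ⟨⟨hs₁pos, hs₁w.trans_le hw01.2⟩, sub_eq_zero.1 hs₁0⟩)
    (show s₂ ∈ _ from ⟨⟨hw0.trans_le hs₂.1, hs₂v.trans_le hv.2⟩, sub_eq_zero.1 hs₂0⟩)
  linarith [hs₂.1]

/-- A step-up procedure with `ρ 1 = 1` rejects everything, so it cannot control the false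
discovery rate for a density in `(α, 1)`. -/
theorem map_one_lt_one {α : ℝ} (hα : α ∈ Ioo (0 : ℝ) 1) {ρ : ℝ → ℝ}
    (hρ : ρ ∈ M.curveClass α 1) : ρ 1 < 1 := by
  have hcv := hρ.1
  by_contra! hcon
  have h1 : ρ 1 = 1 := le_antisymm (hcv.mapsTo ⟨zero_le_one, le_rfl⟩).2 hcon
  have hζ : (1 + α) / 2 ∈ Icc (0 : ℝ) 1 := ⟨by linarith [hα.1], by linarith [hα.2]⟩
  obtain ⟨I, hI⟩ := exists_tendsto_propTrue hζ
  have hone : ∀ n : ℕ, 1 ≤ n → critValue ρ n n = 1 := by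
    intro n hn
    have hn0 : (0 : ℝ) < n := by exact_mod_cast hn
    rw [critValue, div_self hn0.ne', h1]
  have hord : ∀ᶠ n in atTop, 1 ≤ sudOrder ρ 1 n ∧ sudOrder ρ 1 n ≤ n := by
    filter_upwards [eventually_ge_atTop 1] with n hn using ⟨one_le_sudOrder hn, sudOrder_le⟩
  have H := M.eventually_le_FDRDU hI hcv (j := fun n => n) (t := 1) (l := sudOrder ρ 1) (δ := 1)
    (c := (1 + 3 * α) / 4) (c' := (1 + 7 * α) / 8) ?_ hord one_pos ?_
    ⟨by linarith [hα.1], by linarith [hα.2]⟩ (by linarith [hα.2]) (by linarith [hα.2])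
  · linarith [M.limsup_FDRDU_le hρ hζ hI H, hα.2]
  · refine tendsto_const_nhds.congr' ?_
    filter_upwards [eventually_ge_atTop 1] with n hn using (hone n hn).symm
  · filter_upwards [eventually_ge_atTop 1] with n hn
    refine ⟨hn, le_rfl, fun x hx _ => ?_⟩
    refine le_sudIndex (a := sudOrder ρ 1 n) (one_le_sudOrder hn) sudOrder_le hn le_rfl le_rfl
      sudOrder_le fun i _ hli hin => ?_
    have hi1 : 1 ≤ critValue ρ n i := by
      rcases sudOrder_mem (ρ := ρ) (lam := 1) (n := n) with h | h
      · rw [h] at hli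
        rw [le_antisymm hin hli, hone n hn]
      · exact h.2.2.trans (critValue_mono hcv hli hin)
    rw [countLE_eq_numTrue fun k _ _ => (hx k).2.trans hi1, numTrue_univ]
    exact hin

end Model

/-! ### Independence and the false discovery rate of a step-up procedure -/

section Independence

variable {Ω : Type*} [MeasurableSpace Ω] {μ : Measure Ω} [IsProbabilityMeasure μ]

theorem indepFun_prodMk_assoc {β γ δ : Type*} [MeasurableSpace β] [MeasurableSpace γ]
    [MeasurableSpace δ] {X : Ω → β} {Y : Ω → γ} {Z : Ω → δ} (hX : Measurable X) (hY : Measurable Y)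
    (hZ : Measurable Z) (hXY : IndepFun X Y μ) (hXYZ : IndepFun (fun ω => (X ω, Y ω)) Z μ) :
    IndepFun X (fun ω => (Y ω, Z ω)) μ := by
  have hYZ : IndepFun Y Z μ := hXYZ.comp measurable_snd measurable_id
  have := Measure.isProbabilityMeasure_map (μ := μ) hX.aemeasurable
  have := Measure.isProbabilityMeasure_map (μ := μ) hY.aemeasurable
  have := Measure.isProbabilityMeasure_map (μ := μ) hZ.aemeasurable
  rw [indepFun_iff_map_prod_eq_prod_map_map hX.aemeasurable (hY.prodMk hZ).aemeasurable,
    hYZ.map_prod_eq_prod_map_map hY.aemeasurable hZ.aemeasurable, ← Measure.prodAssoc_prod,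
    ← hXY.map_prod_eq_prod_map_map hX.aemeasurable hY.aemeasurable,
    ← hXYZ.map_prod_eq_prod_map_map (hX.prodMk hY).aemeasurable hZ.aemeasurable,
    Measure.map_map MeasurableEquiv.prodAssoc.measurable ((hX.prodMk hY).prodMk hZ)]
  rfl

theorem integral_ite_le_of_indepFun {X : Ω → ℝ} {N : Ω → ℕ} (hX : Measurable X)
    (hN : Measurable N) (hind : IndepFun X N μ)
    (hU : μ.map X = volume.restrict (Icc (0 : ℝ) 1)) {n : ℕ} (hNn : ∀ ω, N ω ≤ n) (h c : ℕ → ℝ)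
    (hc : ∀ k ≤ n, c k ∈ Icc (0 : ℝ) 1) :
    ∫ ω, (if X ω ≤ c (N ω) then h (N ω) else 0) ∂μ = ∫ ω, c (N ω) * h (N ω) ∂μ := by
  have hA : ∀ k, MeasurableSet {ω | X ω ≤ c k} := fun k => measurableSet_le hX measurable_const
  have hB : ∀ k, MeasurableSet {ω | N ω = k} := fun k => hN (measurableSet_singleton k)
  have e1 : ∀ ω, (if X ω ≤ c (N ω) then h (N ω) else 0) = ∑ k ∈ Finset.range (n + 1),
      ({ω | X ω ≤ c k} ∩ {ω | N ω = k}).indicator (fun _ => h k) ω := by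
    intro ω
    rw [Finset.sum_eq_single (N ω)]
    · simp [indicator_apply]
    · intro k _ hk
      simp [hk.symm]
    · intro hk
      exact absurd (Finset.mem_range.2 (Nat.lt_succ_of_le (hNn ω))) hk
  have e2 : ∀ ω, c (N ω) * h (N ω) = ∑ k ∈ Finset.range (n + 1),
      {ω | N ω = k}.indicator (fun _ => c k * h k) ω := by
    intro ω
    rw [Finset.sum_eq_single (N ω)]
    · simp
    · intro k _ hk
      simp [hk.symm]
    · intro hk
      exact absurd (Finset.mem_range.2 (Nat.lt_succ_of_le (hNn ω))) hk
  simp_rw [e1, e2]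
  rw [integral_finsetSum _ fun k _ => (integrable_const _).indicator ((hA k).inter (hB k)),
    integral_finsetSum _ fun k _ => (integrable_const _).indicator (hB k)]
  refine Finset.sum_congr rfl fun k hk => ?_
  rw [integral_indicator_const _ ((hA k).inter (hB k)), integral_indicator_const _ (hB k)]
  have hprod : μ.real ({ω | X ω ≤ c k} ∩ {ω | N ω = k}) =
      μ.real {ω | X ω ≤ c k} * μ.real {ω | N ω = k} := by
    simp only [measureReal_def]
    rw [← ENNReal.toReal_mul]
    congr 1
    exact hind.measure_inter_preimage_eq_mul _ _ measurableSet_Iic (measurableSet_singleton k)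
  rw [hprod, measureReal_le_of_uniform hX hU (hc k (Nat.lt_succ_iff.1 (Finset.mem_range.1 hk)))]
  simp only [smul_eq_mul]
  ring

end Independence

theorem sudIndex_self_congr {ρ : ℝ → ℝ} {n : ℕ} (hn : 1 ≤ n) {x y : ℕ → ℝ}
    (h : ∀ k < n, x k = y k) : sudIndex ρ n n x = sudIndex ρ n n y := by
  classical
  refine sudIndex_congr hn le_rfl fun j hj1 hjn => ?_
  rw [orderStat_le_iff _ hj1 hjn, orderStat_le_iff _ hj1 hjn]
  have : ∀ s, countLE univ x n s = countLE univ y n s := by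
    intro s
    unfold countLE
    congr 1
    ext k
    simp only [Finset.mem_filter, Finset.mem_range]
    refine and_congr_right fun hk => ?_
    rw [h k hk]
  rw [this]

namespace Model

variable {Θ Ω : Type*} [MeasurableSpace Ω] (M : Model Θ Ω)

/-- The index of the step-up procedure after the `i`-th p-value has been replaced by `0`. -/
noncomputable def looIndex (ρ : ℝ → ℝ) (n i : ℕ) (ω : Ω) : ℕ :=
  sudIndex ρ n n (Function.update (fun k => M.p k ω) i 0)

theorem measurable_looIndex (ρ : ℝ → ℝ) {n : ℕ} (hn : 1 ≤ n) (i : ℕ) :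
    Measurable (M.looIndex ρ n i) := by
  have h : ∀ k, Measurable fun ω => Function.update (fun k => M.p k ω) i 0 k := by
    intro k
    by_cases hk : k = i
    · subst hk
      simp
    · simpa [hk] using M.p_measurable k
  exact measurable_sudIndex h ρ hn le_rfl

theorem indepFun_looIndex (hI : M.NullIID) (hA : M.NullIndepAlt) (ϑ : Θ) (ρ : ℝ → ℝ) {n i : ℕ}
    (hin : i < n) (hi : i ∈ M.trueNulls ϑ) : IndepFun (M.p i) (M.looIndex ρ n i) (M.P ϑ) := by
  classical
  have := M.isProb ϑ
  set I := M.trueNulls ϑ with hIdef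
  set T : Finset I := ((Finset.range n).subtype (· ∈ I)).erase ⟨i, hi⟩ with hT
  have hTmem : ∀ k : I, k ∈ T ↔ (k : ℕ) ≠ i ∧ (k : ℕ) < n := by
    intro k
    simp [hT, Subtype.ext_iff]
  -- the p-values of the other true hypotheses and those of the false hypotheses
  set Y : Ω → T → ℝ := fun ω k => M.p k ω with hY
  set Z : Ω → {k : ℕ // k < n ∧ k ∉ I} → ℝ := fun ω k => M.p k ω with hZ
  have hYm : Measurable Y := measurable_pi_lambda _ fun k => M.p_measurable _
  have hZm : Measurable Z := measurable_pi_lambda _ fun k => M.p_measurable _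
  have hXY : IndepFun (M.p i) Y (M.P ϑ) := by
    have h := (hI ϑ).1.indepFun_finset {⟨i, hi⟩} T (by simp [hT]) fun k => M.p_measurable k
    have hφ : Measurable fun x : ({⟨i, hi⟩} : Finset I) → ℝ =>
        x ⟨⟨i, hi⟩, Finset.mem_singleton_self _⟩ := measurable_pi_apply _
    exact h.comp hφ measurable_id
  have hXYZ : IndepFun (fun ω => (M.p i ω, Y ω)) Z (M.P ϑ) := by
    refine (hA ϑ n).comp (φ := fun x : {k : ℕ // k < n ∧ k ∈ I} → ℝ =>
      (x ⟨i, hin, hi⟩, fun k : T => x ⟨k, ((hTmem k).1 k.2).2, k.1.2⟩)) ?_ measurable_id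
    exact (measurable_pi_apply _).prodMk (measurable_pi_lambda _ fun k => measurable_pi_apply _)
  have h := indepFun_prodMk_assoc (M.p_measurable i) hYm hZm hXY hXYZ
  set q : ℕ → (T → ℝ) × ({k : ℕ // k < n ∧ k ∉ I} → ℝ) → ℝ := fun k yz =>
    if h : ∃ hk : k ∈ I, (⟨k, hk⟩ : I) ∈ T then yz.1 ⟨⟨k, h.1⟩, h.2⟩
    else if h' : k < n ∧ k ∉ I then yz.2 ⟨k, h'⟩ else 0 with hq
  have hqm : ∀ k, Measurable (q k) := by
    intro k
    simp only [hq]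
    split_ifs
    · exact (measurable_pi_apply _).comp measurable_fst
    · exact (measurable_pi_apply _).comp measurable_snd
    · exact measurable_const
  have hfac : M.looIndex ρ n i =
      (fun yz => sudIndex ρ n n fun k => q k yz) ∘ fun ω => (Y ω, Z ω) := by
    ext ω
    refine sudIndex_self_congr (by omega) fun k hk => ?_
    by_cases hki : k = i
    · subst hki
      simp [hq, hTmem, hi]
    · by_cases hkI : k ∈ I
      · simp [hq, hTmem, hki, hkI, hk, hY]
      · simp [hq, hki, hkI, hk, hZ]
  rw [hfac]
  exact h.comp measurable_id (measurable_sudIndex hqm ρ (by omega) le_rfl)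

open scoped Classical in
/-- The false discovery rate of a step-up procedure through leave-one-out indices: a true
hypothesis `i` is rejected only if `p_i` is at most the critical value at its leave-one-out index,
and then that index is the number of rejections. -/
theorem FDR_le_sum_integral (hU : M.NullUniform) (hI : M.NullIID) (hA : M.NullIndepAlt) (ϑ : Θ)
    {ρ : ℝ → ℝ} (hρ : IsCriticalValueFunction ρ) {n : ℕ} (hn : 1 ≤ n) :
    M.FDR ϑ ρ n n ≤ ∑ i ∈ (Finset.range n).filter (· ∈ M.trueNulls ϑ),
      ∫ ω, critValue ρ n (M.looIndex ρ n i ω) * (1 / (M.looIndex ρ n i ω : ℝ)) ∂(M.P ϑ) := by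
  classical
  have := M.isProb ϑ
  set I := M.trueNulls ϑ with hIdef
  set S := (Finset.range n).filter (· ∈ I) with hS
  set g : ℕ → Ω → ℝ := fun i ω => if M.p i ω ≤ critValue ρ n (M.looIndex ρ n i ω) then
    1 / (M.looIndex ρ n i ω : ℝ) else 0 with hg
  have hgnn : ∀ i ω, 0 ≤ g i ω := by
    intro i ω
    simp only [hg]
    split_ifs <;> positivity
  have hg1 : ∀ i ω, g i ω ≤ 1 := by
    intro i ω
    simp only [hg]
    split_ifs
    · rw [one_div]
      exact Nat.cast_inv_le_one _
    · exact zero_le_one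
  have hgm : ∀ i, Measurable (g i) := by
    intro i
    have hm := M.measurable_looIndex ρ hn i
    refine Measurable.ite (measurableSet_le (M.p_measurable i)
      ((measurable_from_top (f := critValue ρ n)).comp hm)) ?_ measurable_const
    exact (measurable_from_top (f := fun k : ℕ => 1 / (k : ℝ))).comp hm
  have hgi : ∀ i, Integrable (g i) (M.P ϑ) := fun i =>
    Integrable.of_bound (hgm i).aestronglyMeasurable 1 (ae_of_all _ fun ω => by
      rw [Real.norm_of_nonneg (hgnn i ω)]
      exact hg1 i ω)
  have hpt : ∀ ω, M.fdp I ρ n n ω ≤ ∑ i ∈ S, g i ω := by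
    intro ω
    set x : ℕ → ℝ := fun k => M.p k ω with hx
    by_cases hm : 1 ≤ sudIndex ρ n n x
    · have hR : M.numRej ρ n n ω = sudIndex ρ n n x := by
        rw [numRej, card_sudRejected hm, countLE_critValue_sudIndex_self hρ hm]
      have hV : M.numFalseRej I ρ n n ω =
          ∑ i ∈ S, if x i ≤ critValue ρ n (sudIndex ρ n n x) then 1 else 0 := by
        rw [M.numFalseRej_eq, if_pos hm, countLE_eq_sum]
      have hR1 : (1 : ℝ) ≤ M.numRej ρ n n ω := by
        rw [hR]
        exact_mod_cast hm
      rw [fdp, max_eq_left hR1, hV, hR]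
      push_cast
      rw [Finset.sum_div]
      refine Finset.sum_le_sum fun i hi => ?_
      split_ifs with hle
      · have hrej : i ∈ sudRejected ρ n n x :=
          mem_sudRejected.2 ⟨Finset.mem_range.1 (Finset.mem_filter.1 hi).1, hm, hle⟩
        have hloo : M.looIndex ρ n i ω = sudIndex ρ n n x :=
          sudIndex_self_update hρ (M.p_mem i ω).1 hrej
        simp only [hg, hloo]
        rw [if_pos hle]
      · rw [zero_div]
        exact hgnn i ω
    · rw [fdp, M.numFalseRej_eq, if_neg hm]
      simpa using Finset.sum_nonneg fun i (_ : i ∈ S) => hgnn i ω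
  calc M.FDR ϑ ρ n n = ∫ ω, M.fdp I ρ n n ω ∂(M.P ϑ) := rfl
    _ ≤ ∫ ω, ∑ i ∈ S, g i ω ∂(M.P ϑ) :=
        integral_mono (M.integrable_fdp _ I ρ hn le_rfl) (integrable_finsetSum _ fun i _ => hgi i)
          hpt
    _ = ∑ i ∈ S, ∫ ω, g i ω ∂(M.P ϑ) := integral_finsetSum _ fun i _ => hgi i
    _ = _ := by
        refine Finset.sum_congr rfl fun i hi => ?_
        obtain ⟨hi1, hi2⟩ := Finset.mem_filter.1 hi
        exact integral_ite_le_of_indepFun (M.p_measurable i) (M.measurable_looIndex ρ hn i)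
          (M.indepFun_looIndex hI hA ϑ ρ (Finset.mem_range.1 hi1) hi2) (hU ϑ i hi2)
          (fun ω => sudIndex_le le_rfl) (fun k => 1 / (k : ℝ)) (critValue ρ n)
          fun k hk => critValue_mem hρ hk

end Model

/-! ### Asymptotic control by truncated curves -/

/-- The critical value function of `aorc α`, truncated at `κ`. -/
noncomputable def truncCritFun (α κ u : ℝ) : ℝ := min (α * u / (1 - u * (1 - α))) κ

section Trunc

variable {α : ℝ} (hα : α ∈ Ioo (0 : ℝ) 1)
include hα

theorem truncCritFun_denom_pos {u : ℝ} (hu : u ≤ 1) : 0 < 1 - u * (1 - α) := by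
  nlinarith [hα.1, mul_le_mul_of_nonneg_right hu (sub_nonneg.2 hα.2.le)]

theorem isCriticalValueFunction_truncCritFun {κ : ℝ} (hκ : κ ∈ Ioc (0 : ℝ) 1) :
    IsCriticalValueFunction (truncCritFun α κ) where
  mapsTo u hu := by
    have hd := truncCritFun_denom_pos hα hu.2
    exact ⟨le_min (div_nonneg (mul_nonneg hα.1.le hu.1) hd.le) hκ.1.le,
      (min_le_right _ _).trans hκ.2⟩
  monotoneOn u hu v hv huv := by
    refine min_le_min_right κ ?_
    rw [div_le_div_iff₀ (truncCritFun_denom_pos hα hu.2) (truncCritFun_denom_pos hα hv.2)]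
    nlinarith [hα.1, mul_le_mul_of_nonneg_left huv hα.1.le]
  continuousOn := by
    unfold truncCritFun
    refine ContinuousOn.inf (ContinuousOn.div (by fun_prop) (by fun_prop) fun u hu => ?_)
      continuousOn_const
    exact (truncCritFun_denom_pos hα hu.2).ne'
  map_zero := by simp [truncCritFun, hκ.1.le]
  pos u hu := lt_min (div_pos (mul_pos hα.1 hu.1) (truncCritFun_denom_pos hα hu.2)) hκ.1

theorem truncCritFun_aorc {κ t : ℝ} (ht : t ∈ Icc (0 : ℝ) 1) (htκ : t ≤ κ) :
    truncCritFun α κ (aorc α t) = t := by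
  have hd := aorc_denom_pos hα ht.1
  have h : α * aorc α t / (1 - aorc α t * (1 - α)) = t := by
    rw [div_eq_iff (truncCritFun_denom_pos hα (aorc_le_one hα ht)).ne']
    unfold aorc
    field_simp
    ring
  rw [truncCritFun, h, min_eq_left htκ]

theorem truncCritFun_mul_le {κ u : ℝ} (hu : u ≤ 1) :
    truncCritFun α κ u * (1 - u) ≤ α * u * (1 - truncCritFun α κ u) := by
  have h : truncCritFun α κ u ≤ α * u / (1 - u * (1 - α)) := min_le_left _ _
  rw [le_div_iff₀ (truncCritFun_denom_pos hα hu)] at h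
  linarith

end Trunc

namespace Model

variable {Θ Ω : Type*} [MeasurableSpace Ω] (M : Model Θ Ω)

/-- For every `ϑ`, the integrand in the leave-one-out representation is at most
`(α + o(1)) / n_0` up to a probability `O(1 / n)`, because a step-up procedure cannot reject more
than the empirical distribution function allows. -/
theorem FDR_truncCritFun_le {α : ℝ} (hα : α ∈ Ioo (0 : ℝ) 1) (hU : M.NullUniform) (hI : M.NullIID)
    (hA : M.NullIndepAlt) {κ : ℝ} (hκ : κ ∈ Ioo (0 : ℝ) 1) (ϑ : Θ) {n : ℕ} (hn : 1 ≤ n)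
    {ε C : ℝ} (hε : 0 ≤ ε) {E : Set Ω} (hE : MeasurableSet E) (hEC : (M.P ϑ).real Eᶜ ≤ C / n)
    (hEs : ∀ ω ∈ E, ∀ s ∈ Icc (0 : ℝ) 1,
      |(countLE (M.trueNulls ϑ) (fun i => M.p i ω) n s : ℝ) - numTrue (M.trueNulls ϑ) n * s| ≤
        ε * n) :
    M.FDR ϑ (truncCritFun α κ) n n ≤ α + (ε + 1 / n) / (1 - κ) + C / n := by
  classical
  have := M.isProb ϑ
  set I := M.trueNulls ϑ with hIdef
  set ρ := truncCritFun α κ with hρdef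
  have hρ : IsCriticalValueFunction ρ :=
    isCriticalValueFunction_truncCritFun hα ⟨hκ.1, hκ.2.le⟩
  have hn0 : (0 : ℝ) < n := by exact_mod_cast hn
  have hκ1 : 0 < 1 - κ := sub_pos.2 hκ.2
  set B := α + (ε + 1 / n) / (1 - κ) with hB
  have hB0 : 0 ≤ B := by
    have := hα.1
    positivity
  have hC0 : 0 ≤ C / n := measureReal_nonneg.trans hEC
  refine (M.FDR_le_sum_integral hU hI hA ϑ hρ hn).trans ?_
  rcases Nat.eq_zero_or_pos (numTrue I n) with h0 | hpos
  · have hS : (Finset.range n).filter (· ∈ I) = ∅ := by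
      refine Finset.card_eq_zero.1 (Eq.trans ?_ h0)
      unfold numTrue
      congr
    rw [hS, Finset.sum_empty]
    linarith
  have hN0 : (0 : ℝ) < numTrue I n := by exact_mod_cast hpos
  have hterm : ∀ i ∈ (Finset.range n).filter (· ∈ I),
      ∫ ω, critValue ρ n (M.looIndex ρ n i ω) * (1 / (M.looIndex ρ n i ω : ℝ)) ∂(M.P ϑ) ≤
        (B + C / n) / numTrue I n := by
    intro i hi
    have hin : i < n := Finset.mem_range.1 (Finset.mem_filter.1 hi).1
    set φ : ℕ → ℝ := fun k => critValue ρ n k * (1 / (k : ℝ)) with hφ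
    have hτ : ∀ k, 1 ≤ k → k ≤ n → critValue ρ n k ≤ (k : ℝ) / n := by
      intro k hk1 hkn
      have hu := natCast_div_mem hkn
      have h1 := truncCritFun_mul_le hα (κ := κ) hu.2
      have h2 := (critValue_mem hρ hkn).2
      change critValue ρ n k * _ ≤ _ * (1 - critValue ρ n k) at h1
      have h3 := mul_le_mul_of_nonneg_right (mul_le_of_le_one_left hu.1 hα.2.le)
        (sub_nonneg.2 h2)
      linarith
    have hbound : ∀ ω, φ (M.looIndex ρ n i ω) ≤
        (B + Eᶜ.indicator (fun _ => (1 : ℝ)) ω) / numTrue I n := by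
      intro ω
      set x : ℕ → ℝ := fun k => M.p k ω with hx
      set m := M.looIndex ρ n i ω with hm
      have hm1 : 1 ≤ m := one_le_sudIndex_self_update hρ hin x
      have hmn : m ≤ n := sudIndex_le le_rfl
      have hm0 : (0 : ℝ) < m := by exact_mod_cast hm1
      set τ := critValue ρ n m with hτdef
      have hτ01 : τ ∈ Icc (0 : ℝ) 1 := critValue_mem hρ hmn
      have hτm : n * τ ≤ m := by
        have h := hτ m hm1 hmn
        rwa [le_div_iff₀ hn0, mul_comm] at h
      rw [le_div_iff₀ hN0]
      simp only [hφ]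
      rw [mul_one_div, div_mul_eq_mul_div, div_le_iff₀ hm0]
      by_cases hω : ω ∈ E
      · rw [indicator_of_notMem (by simpa using hω), add_zero]
        have hcount : (m : ℝ) ≤ n - numTrue I n + numTrue I n * τ + ε * n + 1 := by
          have h1 : m ≤ countLE univ (Function.update x i 0) n τ := sudIndex_self_le_countLE hm1
          have h2 := countLE_update_le (n := n) (i := i) x τ
          have h3 := countLE_univ I x n τ
          have h4 := countLE_le_numTrue Iᶜ x n τ
          have h5 := numTrue_add_compl I n
          have h6 : m + numTrue I n ≤ n + countLE I x n τ + 1 := by omega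
          have h7 : (m : ℝ) + numTrue I n ≤ n + countLE I x n τ + 1 := by exact_mod_cast h6
          have h8 := (abs_le.1 (hEs ω hω τ hτ01)).2
          linarith
        have hτκ : 1 - κ ≤ 1 - τ := by
          have : τ ≤ κ := min_le_right _ _
          linarith
        have hτu := truncCritFun_mul_le hα (κ := κ) (natCast_div_mem hmn).2
        change τ * _ ≤ _ * (1 - τ) at hτu
        -- clear denominators in the bound for `ρ`
        have hτu' : τ * (n - m) ≤ α * m * (1 - τ) := by
          have h := mul_le_mul_of_nonneg_left hτu hn0.le
          have e1 : n * (τ * (1 - (m : ℝ) / n)) = τ * (n - m) := by field_simp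
          have e2 : n * (α * ((m : ℝ) / n) * (1 - τ)) = α * m * (1 - τ) := by field_simp
          rwa [e1, e2] at h
        have hw : 0 < 1 - τ := hκ1.trans_le hτκ
        have h1 : numTrue I n * (1 - τ) ≤ n - m + n * (ε + 1 / n) := by
          have : n * (ε + 1 / n) = ε * n + 1 := by field_simp
          linarith
        have h2 : τ * numTrue I n * (1 - τ) ≤ (α * m + m * ((ε + 1 / n) / (1 - κ))) * (1 - τ) := by
          have h3 := mul_le_mul_of_nonneg_left h1 hτ01.1
          have h4 : n * τ * (ε + 1 / n) ≤ m * (ε + 1 / n) :=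
            mul_le_mul_of_nonneg_right hτm (by positivity)
          have h5 : (ε + 1 / n) ≤ (ε + 1 / n) / (1 - κ) * (1 - τ) := by
            rw [div_mul_eq_mul_div, le_div_iff₀ hκ1]
            exact mul_le_mul_of_nonneg_left hτκ (by positivity)
          have h6 := mul_le_mul_of_nonneg_left h5 hm0.le
          linarith
        have h7 := le_of_mul_le_mul_right h2 hw
        rw [hB]
        linarith
      · rw [indicator_of_mem (by simpa using hω)]
        have h1 : (numTrue I n : ℝ) ≤ n := by exact_mod_cast numTrue_le I n
        have h2 : τ * numTrue I n ≤ n * τ := by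
          rw [mul_comm]
          exact mul_le_mul_of_nonneg_right h1 hτ01.1
        have h3 : 0 ≤ B * m := by positivity
        linarith
    have hnn : ∀ ω, 0 ≤ φ (M.looIndex ρ n i ω) := fun ω =>
      mul_nonneg (critValue_mem hρ (sudIndex_le le_rfl)).1 (by positivity)
    have hint : Integrable (fun ω => (B + Eᶜ.indicator (fun _ => (1 : ℝ)) ω) / numTrue I n)
        (M.P ϑ) :=
      ((integrable_const B).add ((integrable_const 1).indicator hE.compl)).div_const _
    refine (integral_mono_of_nonneg (ae_of_all _ hnn) hint (ae_of_all _ hbound)).trans ?_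
    rw [integral_div, integral_add (integrable_const B) ((integrable_const 1).indicator hE.compl),
      integral_indicator_const _ hE.compl]
    simp only [integral_const, probReal_univ, smul_eq_mul, one_mul, mul_one]
    gcongr
  refine (Finset.sum_le_sum hterm).trans ?_
  have hcard : (((Finset.range n).filter (· ∈ I)).card : ℝ) = numTrue I n := by
    unfold numTrue
    congr
  rw [Finset.sum_const, nsmul_eq_mul, hcard, mul_div_cancel₀ _ hN0.ne']

theorem truncCritFun_mem_curveClass {α : ℝ} (hα : α ∈ Ioo (0 : ℝ) 1) (hU : M.NullUniform)
    (hI : M.NullIID) (hA : M.NullIndepAlt)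
    (hDU : ∀ ρ, IsCriticalValueFunction ρ → ∀ (I : Set ℕ) (ζ : ℝ), ζ ∈ Icc (0 : ℝ) 1 →
      Tendsto (propTrue I) atTop (𝓝 ζ) → M.DULeSup 1 ρ I) {κ : ℝ} (hκ : κ ∈ Ioo (0 : ℝ) 1) :
    truncCritFun α κ ∈ M.curveClass α 1 := by
  have hρ := isCriticalValueFunction_truncCritFun hα ⟨hκ.1, hκ.2.le⟩
  refine ⟨hρ, fun I ζ hζ hIζ => ⟨hDU _ hρ I ζ hζ hIζ, ?_⟩⟩
  have hord : ∀ n, sudOrder (truncCritFun α κ) 1 n = n := by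
    intro n
    rcases sudOrder_mem (ρ := truncCritFun α κ) (lam := 1) (n := n) with h | ⟨_, _, h⟩
    · exact h
    · exact absurd (h.trans (min_le_right _ _)) hκ.2.not_ge
  simp_rw [hord]
  have : Nonempty Θ := ⟨(M.H_nonempty 0).some⟩
  have hκ1 : 0 < 1 - κ := sub_pos.2 hκ.2
  refine le_of_forall_pos_le_add fun η hη => ?_
  have hε : 0 < η * (1 - κ) / 2 := by positivity
  obtain ⟨C, hC0, hC⟩ := exists_uniform_const hε
  have hlim : Tendsto (fun n : ℕ => α + (η * (1 - κ) / 2 + 1 / n) / (1 - κ) + C / n) atTop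
      (𝓝 (α + (η * (1 - κ) / 2 + 0) / (1 - κ) + 0)) :=
    (((tendsto_const_nhds.add (tendsto_const_div_atTop_nhds_zero_nat 1)).div_const _).const_add
      α).add (tendsto_const_div_atTop_nhds_zero_nat C)
  have hev := hlim.eventually_lt_const (u := α + η) (by
    have : (η * (1 - κ) / 2 + 0) / (1 - κ) = η / 2 := by field_simp; ring
    linarith)
  refine limsup_le_of_le ?_ ?_
  · refine IsBoundedUnder.isCoboundedUnder_le (isBoundedUnder_of ⟨0, fun n => ?_⟩)
    exact Real.iSup_nonneg fun ϑ => M.expFDP_nonneg _ _ _ _ _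
  · filter_upwards [hev, eventually_ge_atTop 1] with n hn hn1
    refine ciSup_le fun ϑ => ?_
    have := M.isProb ϑ
    obtain ⟨E, hE, hEC, hEs⟩ := hC (M.P ϑ) M.p (M.trueNulls ϑ) M.p_measurable (hU ϑ) (hI ϑ).1 n hn1
    exact (M.FDR_truncCritFun_le hα hU hI hA hκ ϑ hn1 hε.le hE hEC hEs).trans hn.le

/-! ### Power of step-up procedures -/

theorem aorc_map_le {α : ℝ} (hα : α ∈ Ioo (0 : ℝ) 1) {ρ : ℝ → ℝ} (hρ : ρ ∈ M.curveClass α 1)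
    {u : ℝ} (hu : u ∈ Icc (0 : ℝ) 1) : aorc α (ρ u) ≤ u := by
  have h := M.aorc_le_rejectionCurve_of_le hα hρ (hρ.1.mapsTo hu)
  exact EReal.coe_le_coe_iff.1 (h.trans (iInf₂_le u ⟨hu, rfl⟩))

/-- When the proportion of true hypotheses exceeds `critDensity α κ` by a fixed amount and the
empirical distribution function of their p-values is nearly uniform, the critical value used by a
step-up procedure in the class is less than `κ`; there the critical values of `ρf` dominate. -/
theorem numFalseRej_mono {α : ℝ} (hα : α ∈ Ioo (0 : ℝ) 1) {κ : ℝ} (hκ : κ ∈ Ioo (0 : ℝ) 1)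
    {ρf ρ : ℝ → ℝ} (hρf : IsCriticalValueFunction ρf)
    (hf : ∀ t ∈ Icc (0 : ℝ) κ, rejectionCurve ρf t = (aorc α t : EReal))
    (hρ : ρ ∈ M.curveClass α 1) {I : Set ℕ} {n : ℕ} (hn : 1 ≤ n) {η ε : ℝ}
    (hη : critDensity α κ + η ≤ propTrue I n) (hη0 : 0 < η)
    (hε : ε < η * (1 - ρ 1)) {ω : Ω}
    (hω : ∀ s ∈ Icc (0 : ℝ) 1,
      |(countLE I (fun i => M.p i ω) n s : ℝ) - numTrue I n * s| ≤ ε * n) (J : Set ℕ) :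
    M.numFalseRej J ρ n n ω ≤ M.numFalseRej J ρf n n ω := by
  have hcv := hρ.1
  have hn0 : (0 : ℝ) < n := by exact_mod_cast hn
  set x : ℕ → ℝ := fun i => M.p i ω with hx
  rw [M.numFalseRej_eq, M.numFalseRej_eq]
  by_cases hm1 : 1 ≤ sudIndex ρ n n x
  swap
  · rw [if_neg hm1]
    exact Nat.zero_le _
  have hmn : sudIndex ρ n n x ≤ n := sudIndex_le le_rfl
  have hcount := sudIndex_self_le_countLE hm1
  set m := sudIndex ρ n n x with hm
  have hu : (m : ℝ) / n ∈ Icc (0 : ℝ) 1 := natCast_div_mem hmn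
  set u := (m : ℝ) / n with hudef
  set τ := critValue ρ n m with hτ
  have hτ01 : τ ∈ Icc (0 : ℝ) 1 := critValue_mem hcv hmn
  have hτu : aorc α τ ≤ u := M.aorc_map_le hα hρ hu
  have hτ1 : τ ≤ ρ 1 := hcv.monotoneOn hu ⟨zero_le_one, le_rfl⟩ hu.2
  have hule : u ≤ 1 - propTrue I n * (1 - τ) + ε := by
    have h3 := countLE_univ I x n τ
    have h4 := countLE_le_numTrue Iᶜ x n τ
    have h5 := numTrue_add_compl I n
    have h6 : m + numTrue I n ≤ n + countLE I x n τ := by omega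
    have h7 : (m : ℝ) + numTrue I n ≤ n + countLE I x n τ := by exact_mod_cast h6
    have h8 := (abs_le.1 (hω τ hτ01)).2
    rw [numTrue_eq_mul_propTrue I hn] at h7 h8
    rw [hudef, div_le_iff₀ hn0]
    linarith
  have hlt : τ < κ := by
    by_contra! hcon
    have h1 : critDensity α τ ≤ critDensity α κ := by
      rcases hcon.eq_or_lt with h | h
      · rw [h]
      · exact (critDensity_strictAnti hα hκ.1.le h).le
    rw [aorc_eq_line hα hτ01.1] at hτu
    have h2 := mul_le_mul_of_nonneg_right (add_le_add_left h1 η) (sub_nonneg.2 hτ01.2)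
    have h3 := mul_le_mul_of_nonneg_right hη (sub_nonneg.2 hτ01.2)
    have h4 := mul_le_mul_of_nonneg_left (sub_le_sub_left hτ1 1) hη0.le
    linarith
  have hle : τ ≤ critValue ρf n m := by
    obtain ⟨h1, h2⟩ := map_aorc_of_rejectionCurve_eq hρf hτ01.1 (hf τ ⟨hτ01.1, hlt.le⟩)
    calc τ = ρf (aorc α τ) := h2.symm
      _ ≤ ρf u := hρf.monotoneOn h1 hu hτu
  have hmf : m ≤ sudIndex ρf n n x :=
    le_sudIndex_self hm1 hmn (hcount.trans (countLE_mono _ _ _ hle))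
  rw [if_pos hm1, if_pos (hm1.trans hmf)]
  exact countLE_mono _ _ _ (hle.trans (critValue_mono hρf hmf (sudIndex_le le_rfl)))

/-- The integrand of the power. -/
noncomputable def tdp (I : Set ℕ) (ρ : ℝ → ℝ) (n : ℕ) (ω : Ω) : ℝ :=
  ((M.numRej ρ n n ω : ℝ) - M.numFalseRej I ρ n n ω) / max ((n : ℝ) - numTrue I n) 1

theorem tdp_eq (I : Set ℕ) (ρ : ℝ → ℝ) (n : ℕ) (ω : Ω) :
    M.tdp I ρ n ω = (M.numFalseRej Iᶜ ρ n n ω : ℝ) / max (numTrue Iᶜ n : ℝ) 1 := by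
  have h1 : (numTrue Iᶜ n : ℝ) = n - numTrue I n := by
    rw [eq_sub_iff_add_eq']
    exact_mod_cast numTrue_add_compl I n
  rw [tdp, M.numRej_eq_add I, ← h1]
  push_cast
  rw [add_sub_cancel_left]

theorem tdp_mem (I : Set ℕ) (ρ : ℝ → ℝ) (n : ℕ) (ω : Ω) : M.tdp I ρ n ω ∈ Icc (0 : ℝ) 1 := by
  rw [tdp_eq]
  refine ⟨by positivity, div_le_one_of_le₀ (le_max_of_le_left ?_) (by positivity)⟩
  exact_mod_cast M.numFalseRej_le_numTrue Iᶜ ρ n n ω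

theorem integrable_tdp (μ : Measure Ω) [IsProbabilityMeasure μ] (I : Set ℕ) (ρ : ℝ → ℝ) {n : ℕ}
    (hn : 1 ≤ n) : Integrable (M.tdp I ρ n) μ := by
  have h : M.tdp I ρ n = _ := funext fun ω => M.tdp_eq I ρ n ω
  have hm : Measurable (M.tdp I ρ n) := by
    rw [h]
    exact (measurable_from_top.comp (M.measurable_numFalseRej Iᶜ ρ hn le_rfl)).div_const _
  refine Integrable.of_bound hm.aestronglyMeasurable 1 (ae_of_all _ fun ω => ?_)
  rw [Real.norm_of_nonneg (M.tdp_mem I ρ n ω).1]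
  exact (M.tdp_mem I ρ n ω).2

theorem power_mem (ϑ : Θ) (ρ : ℝ → ℝ) {n : ℕ} (hn : 1 ≤ n) :
    M.power ϑ ρ n n ∈ Icc (0 : ℝ) 1 := by
  have := M.isProb ϑ
  refine ⟨integral_nonneg fun ω => (M.tdp_mem _ ρ n ω).1, ?_⟩
  have h := integral_mono (M.integrable_tdp (M.P ϑ) (M.trueNulls ϑ) ρ hn)
    (integrable_const (1 : ℝ)) fun ω => (M.tdp_mem _ ρ n ω).2
  simpa [tdp, power] using h

theorem liminf_power_sub_nonneg {α : ℝ} (hα : α ∈ Ioo (0 : ℝ) 1) (hU : M.NullUniform)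
    (hI : M.NullIID) {κ : ℝ} (hκ : κ ∈ Ioo (0 : ℝ) 1) {ρf ρ : ℝ → ℝ}
    (hρf : IsCriticalValueFunction ρf)
    (hf : ∀ t ∈ Icc (0 : ℝ) κ, rejectionCurve ρf t = (aorc α t : EReal))
    (hρ : ρ ∈ M.curveClass α 1) {ϑ : Θ} (hϑ : ϑ ∈ M.paramSet α κ) :
    0 ≤ liminf (fun n => M.power ϑ ρf n n - M.power ϑ ρ n n) atTop := by
  have := M.isProb ϑ
  set I := M.trueNulls ϑ with hIdef
  have hz : critDensity α κ < liminf (propTrue I) atTop := hϑ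
  obtain ⟨b, hb1, hb2⟩ := exists_between hz
  have hbdd : IsBoundedUnder (· ≥ ·) atTop (propTrue I) :=
    isBoundedUnder_of ⟨0, fun n => (propTrue_mem I n).1⟩
  have hprop := eventually_lt_of_lt_liminf hb2 hbdd
  set η := b - critDensity α κ with hη
  have hη0 : 0 < η := sub_pos.2 hb1
  obtain ⟨ε, hε0, hε⟩ := exists_between (mul_pos hη0 (sub_pos.2 (M.map_one_lt_one hα hρ)))
  obtain ⟨C, hC0, hC⟩ := exists_uniform_const hε0
  have hlow : ∀ᶠ n : ℕ in atTop, -(C / n) ≤ M.power ϑ ρf n n - M.power ϑ ρ n n := by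
    filter_upwards [hprop, eventually_ge_atTop 1] with n hn hn1
    obtain ⟨E, hE, hEC, hEs⟩ := hC (M.P ϑ) M.p I M.p_measurable (hU ϑ) (hI ϑ).1 n hn1
    have hpt : ∀ ω, -(Eᶜ.indicator (fun _ => (1 : ℝ)) ω) ≤ M.tdp I ρf n ω - M.tdp I ρ n ω := by
      intro ω
      by_cases hω : ω ∈ E
      · rw [indicator_of_notMem (by simpa using hω), neg_zero, sub_nonneg, tdp_eq, tdp_eq]
        have := M.numFalseRej_mono hα hκ hρf hf hρ hn1 (by linarith) hη0 hε (hEs ω hω) Iᶜ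
        gcongr
      · rw [indicator_of_mem (by simpa using hω)]
        linarith [(M.tdp_mem I ρf n ω).1, (M.tdp_mem I ρ n ω).2]
    have hint := integral_mono ((integrable_const (1 : ℝ)).indicator hE.compl).neg
      ((M.integrable_tdp (M.P ϑ) I ρf hn1).sub (M.integrable_tdp (M.P ϑ) I ρ hn1)) hpt
    simp only [Pi.neg_apply, Pi.sub_apply] at hint
    rw [integral_neg, integral_indicator_const _ hE.compl,
      integral_sub (M.integrable_tdp _ I ρf hn1) (M.integrable_tdp _ I ρ hn1), smul_eq_mul,
      mul_one] at hint
    exact (neg_le_neg hEC).trans hint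
  have hlim : Tendsto (fun n : ℕ => -(C / n)) atTop (𝓝 0) := by
    simpa using (tendsto_const_div_atTop_nhds_zero_nat C).neg
  rw [← hlim.liminf_eq]
  refine liminf_le_liminf hlow hlim.isBoundedUnder_ge ?_
  refine IsBoundedUnder.isCoboundedUnder_ge ⟨1, ?_⟩
  rw [eventually_map]
  filter_upwards [eventually_ge_atTop 1] with n hn
  linarith [(M.power_mem ϑ ρf hn).2, (M.power_mem ϑ ρ hn).1]

end Model

end MultipleTesting

theorem theorem5p5 {Θ Ω : Type*} [MeasurableSpace Ω] (M : Model Θ Ω)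
    (α : ℝ) (hα : α ∈ Ioo (0 : ℝ) 1) :
    -- (i)
    (∀ lam ∈ Icc (0 : ℝ) 1, ∀ ρ ∈ M.curveClass α lam,
      (∀ t ∈ Icc (0 : ℝ) lam, (aorc α t : EReal) ≤ rejectionCurve ρ t) ∧
      (lam < 1 → ∀ τ ∈ Ioc lam 1,
        (∀ t ∈ Ioc lam τ, rejectionCurve ρ t ≤ (aorc α t : EReal)) →
        ∀ t ∈ Ioc lam τ, rejectionCurve ρ t = (aorc α t : EReal))) ∧
    -- (ii)
    (∀ lam ∈ Icc (0 : ℝ) 1, lam < 1 → ∀ ρ ∈ M.curveClass α lam,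
      (∀ ζ ∈ Ioo α 1, {t : ℝ | t ∈ Ioo (0 : ℝ) 1 ∧ 1 - ζ + ζ * ρ t = t}.Subsingleton) →
      ∀ t ∈ Icc (0 : ℝ) 1, (aorc α t : EReal) ≤ rejectionCurve ρ t) ∧
    -- (iii)
    (M.NullUniform → M.NullIID → M.NullIndepAlt →
      -- the infimum, in a model for which the asymptotic FDR of a step-up procedure under a
      -- Dirac-uniform configuration never exceeds its asymptotic supremum over the model
      ((∀ ρ, IsCriticalValueFunction ρ → ∀ (I : Set ℕ) (ζ : ℝ), ζ ∈ Icc (0 : ℝ) 1 →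
          Tendsto (propTrue I) atTop (𝓝 ζ) → M.DULeSup 1 ρ I) →
        ∀ t ∈ Ico (0 : ℝ) 1,
          ⨅ ρ ∈ M.curveClass α 1, rejectionCurve ρ t = (aorc α t : EReal)) ∧
      -- the power comparison
      (∀ κ ∈ Ioo (0 : ℝ) 1, ∀ ρf ∈ M.curveClass α 1,
        (∀ t ∈ Icc (0 : ℝ) κ, rejectionCurve ρf t = (aorc α t : EReal)) →
        ∀ ρ ∈ M.curveClass α 1, ∀ ϑ ∈ M.paramSet α κ,
          0 ≤ liminf (fun n => M.power ϑ ρf n n - M.power ϑ ρ n n) atTop)) := by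
  refine ⟨fun lam hlam ρ hρ => ⟨fun t ht => M.aorc_le_rejectionCurve_of_le hα hρ ht,
    fun _ τ hτ hle t ht => le_antisymm (hle t ht)
      (M.aorc_le_rejectionCurve_of_rejectionCurve_le hα hlam hρ hτ hle ht)⟩,
    fun lam _ _ ρ hρ huniq t ht => M.aorc_le_rejectionCurve_of_subsingleton hα hρ huniq ht,
    fun hU hI hA => ⟨fun hDU t ht => ?_, fun κ hκ ρf hρf hf ρ hρ ϑ hϑ =>
      M.liminf_power_sub_nonneg hα hU hI hκ hρf.1 hf hρ hϑ⟩⟩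
  have ht1 : t ∈ Icc (0 : ℝ) 1 := ⟨ht.1, ht.2.le⟩
  refine le_antisymm ?_ (le_iInf₂ fun ρ hρ => M.aorc_le_rejectionCurve_of_le hα hρ ht1)
  -- the infimum is attained by the curve truncated at some `κ ≥ t`
  have hκ : max t (1 / 2) ∈ Ioo (0 : ℝ) 1 :=
    ⟨lt_max_of_lt_right (by norm_num), max_lt ht.2 (by norm_num)⟩
  refine (iInf₂_le _ (M.truncCritFun_mem_curveClass hα hU hI hA hDU hκ)).trans (iInf₂_le _ ⟨?_, ?_⟩)
  · exact ⟨div_nonneg ht.1 (aorc_denom_pos hα ht.1).le, aorc_le_one hα ht1⟩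
  · exact truncCritFun_aorc hα ht1 (le_max_left _ _)
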